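/- Let $R$ be a commutative noetherian ring, and let $\mathfrak c$ be a finite intersection of maximal ideals of $R$. For an ideal $\mathfrak a$ of $R$, let $\widehat R^{\mathfrak a}$ denote the $\mathfrak a$-adic completion of $R$, and for an $R$-module $M$ set $\Gamma_{\mathfrak a}(M)=\{x\in M\mid \mathfrak a^n x=0\text{ for } n\gg 0\}$; the module $M$ is $\mathfrak a$-torsion if $M=\Gamma_{\mathfrak a}(M)$, and in this case $M$ is naturally an $\widehat R^{\mathfrak a}$-module. Let $T$ and $L$ be $R$-modules such that $T$ is $\mathfrak c$-torsion, and let $\mathcal G$ be a finite set of maximal ideals of $R$ containing $\operatorname{Supp}_R(T)\cap\operatorname{Supp}_R(L)$. Then for all $i\ge 0$ there are $R$-module isomorphisms $$\operatorname{Ext}^i_R(T,L)\;\cong\;\bigoplus_{\mathfrak m\in\mathcal G}\operatorname{Ext}^i_{\widehat R^{\mathfrak m}}\bigl(\Gamma_{\mathfrak m}(T),\,\widehat R^{\mathfrak m}\otimes_R L\bigr)\;\cong\;\bigoplus_{\mathfrak m\in\mathcal G}\operatorname{Ext}^i_{R_{\mathfrak m}}(T_{\mathfrak m},L_{\mathfrak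 m}).$$ The second isomorphism is $\widehat R^{\mathfrak a}$-linear for each ideal $\mathfrak a\subseteq\bigcap_{\mathfrak m\in\mathcal G}\mathfrak m$; here, for $\mathfrak m\in\mathcal G$, the module $\operatorname{Ext}^i_{R_{\mathfrak m}}(T_{\mathfrak m},L_{\mathfrak m})$ is an $\widehat R^{\mathfrak m}$-module through the action of $\widehat R^{\mathfrak m}$ on the $\mathfrak m$-torsion module $T_{\mathfrak m}$, and $\widehat R^{\mathfrak a}$ acts on each summand on both sides through the natural map $\widehat R^{\mathfrak a}\to\widehat R^{\mathfrak m}$. Hence, for each such $\mathfrak a$, $\operatorname{Ext}^i_R(T,L)$ has an $\widehat R^{\mathfrak a}$-module structure that is compatible with its $R$-module structure and for which the first isomorphism is also $\widehat R^{\mathfrak a}$-linear. -/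

import Mathlib

open CategoryTheory CategoryTheory.Abelian
open scoped TensorProduct DirectSum

universe u

noncomputable section

/-! The `𝔞`-torsion submodule `Γ_𝔞(M) = {x | 𝔞ⁿ x = 0 for n ≫ 0}` is `Ideal.primaryComponent M 𝔞`,
and the `𝔞`-adic completion of `R` is `AdicCompletion 𝔞 R`. -/

namespace TorsionExt

section Action

variable {R : Type*} [CommRing R] (I : Ideal R) {M : Type*} [AddCommGroup M] [Module R M]

/-- `M` is `I`-torsion: `M = Γ_I(M)`. -/
def IsTorsionModule (M : Type*) [AddCommGroup M] [Module R M] : Prop :=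
  Ideal.primaryComponent M I = ⊤

variable {I}

theorem IsTorsionModule.exists_pow (h : IsTorsionModule I M) (x : M) :
    ∃ n : ℕ, ∀ a ∈ I ^ n, a • x = 0 := by
  have hx : x ∈ Ideal.primaryComponent M I := by
    rw [show Ideal.primaryComponent M I = ⊤ from h]; trivial
  obtain ⟨n, hn⟩ := (Ideal.primaryComponent_mem M I x).1 hx
  exact ⟨n, fun a ha => (Submodule.mem_torsionBySet_iff _ _).1 hn ⟨a, ha⟩⟩

theorem isTorsionModule_of_exists_pow (h : ∀ x : M, ∃ n : ℕ, ∀ a ∈ I ^ n, a • x = 0) :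
    IsTorsionModule I M := by
  refine eq_top_iff.2 fun x _ => (Ideal.primaryComponent_mem M I x).2 ?_
  obtain ⟨n, hn⟩ := h x
  exact ⟨n, (Submodule.mem_torsionBySet_iff _ _).2 fun a => hn a a.2⟩

/-- The action of `s` in the `I`-adic completion on an element `x` of an `I`-torsion module:
choose `n` with `Iⁿ x = 0` and `r : R` with the same image as `s` in `R ⧸ Iⁿ`; then `s x = r x`. -/
def completionSMul (h : IsTorsionModule I M) (s : AdicCompletion I R) (x : M) : M :=
  (Ideal.Quotient.mk_surjective (AdicCompletion.evalₐ I (h.exists_pow x).choose s)).choose • x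

/-- The action does not depend on the choices. -/
theorem completionSMul_eq (h : IsTorsionModule I M) {s : AdicCompletion I R} {x : M} {n : ℕ}
    (hn : ∀ a ∈ I ^ n, a • x = 0) {r : R}
    (hr : Ideal.Quotient.mk (I ^ n) r = AdicCompletion.evalₐ I n s) :
    completionSMul h s x = r • x := by
  obtain ⟨y, rfl⟩ := AdicCompletion.mk_surjective I R s
  have key : ∀ (k : ℕ), (∀ a ∈ I ^ k, a • x = 0) → ∀ r' : R,
      Ideal.Quotient.mk (I ^ k) r' = AdicCompletion.evalₐ I k (AdicCompletion.mk I R y) →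
      r' • x = y (max k n) • x := by
    intro k hk r' hr'
    rw [AdicCompletion.evalₐ_mk, ← AdicCompletion.Ideal.mk_eq_mk I (le_max_left k n),
      Ideal.Quotient.eq] at hr'
    have := hk _ hr'
    rwa [sub_smul, sub_eq_zero] at this
  have key' : r • x = y (max (h.exists_pow x).choose n) • x := by
    rw [AdicCompletion.evalₐ_mk, ← AdicCompletion.Ideal.mk_eq_mk I (le_max_right _ n),
      Ideal.Quotient.eq] at hr
    have := hn _ hr
    rwa [sub_smul, sub_eq_zero] at this
  rw [key']
  exact key _ (h.exists_pow x).choose_spec _ (Ideal.Quotient.mk_surjective _).choose_spec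

/-- If `M` is a module over an `R`-algebra `A` and is `I`-torsion over `R`, then the `I`-adic
completion of `R` acts on `M` by `A`-linear endomorphisms. -/
def completionAction (A : Type*) [CommRing A] [Algebra R A] [Module A M] [IsScalarTower R A M]
    (h : IsTorsionModule I M) : AdicCompletion I R →+* Module.End A M where
  toFun s :=
    { toFun := completionSMul h s
      map_add' := fun x y => by
        obtain ⟨n, hn⟩ := h.exists_pow x
        obtain ⟨k, hk⟩ := h.exists_pow y
        have hx : ∀ a ∈ I ^ max n k, a • x = 0 := fun a ha =>
          hn a (Ideal.pow_le_pow_right (le_max_left _ _) ha)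
        have hy : ∀ a ∈ I ^ max n k, a • y = 0 := fun a ha =>
          hk a (Ideal.pow_le_pow_right (le_max_right _ _) ha)
        obtain ⟨r, hr⟩ := Ideal.Quotient.mk_surjective (AdicCompletion.evalₐ I (max n k) s)
        rw [completionSMul_eq h hx hr, completionSMul_eq h hy hr,
          completionSMul_eq h (fun a ha => by rw [smul_add, hx a ha, hy a ha, add_zero]) hr,
          smul_add]
      map_smul' := fun a x => by
        obtain ⟨n, hn⟩ := h.exists_pow x
        obtain ⟨r, hr⟩ := Ideal.Quotient.mk_surjective (AdicCompletion.evalₐ I n s)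
        have hc : ∀ b : R, b • a • x = a • b • x := fun b => (smul_algebra_smul_comm b a x).symm
        rw [completionSMul_eq h hn hr,
          completionSMul_eq h (fun b hb => by rw [hc, hn b hb, smul_zero]) hr, hc]
        rfl }
  map_one' := by
    ext x
    obtain ⟨n, hn⟩ := h.exists_pow x
    exact (completionSMul_eq h hn (r := 1) (by simp)).trans (one_smul _ _)
  map_zero' := by
    ext x
    obtain ⟨n, hn⟩ := h.exists_pow x
    exact (completionSMul_eq h hn (r := 0) (by simp)).trans (zero_smul _ _)
  map_mul' s t := by
    ext x
    obtain ⟨n, hn⟩ := h.exists_pow x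
    obtain ⟨r, hr⟩ := Ideal.Quotient.mk_surjective (AdicCompletion.evalₐ I n s)
    obtain ⟨q, hq⟩ := Ideal.Quotient.mk_surjective (AdicCompletion.evalₐ I n t)
    change completionSMul h (s * t) x = completionSMul h s (completionSMul h t x)
    rw [completionSMul_eq h hn hq, completionSMul_eq h hn (r := r * q) (by simp [hr, hq]),
      completionSMul_eq h (fun a ha => by rw [smul_comm, hn a ha, smul_zero]) hr, mul_smul]
  map_add' s t := by
    ext x
    obtain ⟨n, hn⟩ := h.exists_pow x
    obtain ⟨r, hr⟩ := Ideal.Quotient.mk_surjective (AdicCompletion.evalₐ I n s)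
    obtain ⟨q, hq⟩ := Ideal.Quotient.mk_surjective (AdicCompletion.evalₐ I n t)
    change completionSMul h (s + t) x = completionSMul h s x + completionSMul h t x
    rw [completionSMul_eq h hn hr, completionSMul_eq h hn hq,
      completionSMul_eq h hn (r := r + q) (by simp [hr, hq]), add_smul]

variable (I M) in
theorem isTorsionModule_primaryComponent :
    IsTorsionModule I (Ideal.primaryComponent M I) := by
  refine isTorsionModule_of_exists_pow fun x => ?_
  obtain ⟨n, hn⟩ := (Ideal.primaryComponent_mem M I x.1).1 x.2
  exact ⟨n, fun a ha => Subtype.ext ((Submodule.mem_torsionBySet_iff _ _).1 hn ⟨a, ha⟩)⟩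

/-- `Γ_I(M)` as a module over the `I`-adic completion of `R`. -/
instance primaryComponentModule :
    Module (AdicCompletion I R) (Ideal.primaryComponent M I) :=
  Module.compHom _ (completionAction R (isTorsionModule_primaryComponent I M))

end Action

/-- The natural map from the `I`-adic to the `J`-adic completion when `I ≤ J`. -/
def completionMap {R : Type*} [CommRing R] {I J : Ideal R} (h : I ≤ J) :
    AdicCompletion I R →ₐ[R] AdicCompletion J R :=
  AdicCompletion.liftAlgHom J
    (fun n => (Ideal.Quotient.factorₐ R (Ideal.pow_right_mono h n)).comp (AdicCompletion.evalₐ I n))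
    (by
      intro m n hle
      ext x
      obtain ⟨y, rfl⟩ := AdicCompletion.mk_surjective I R x
      simp only [AlgHom.comp_apply, AdicCompletion.evalₐ_mk, Ideal.Quotient.factorₐ_apply_mk]
      have := (Ideal.Quotient.eq.1 (AdicCompletion.Ideal.mk_eq_mk I hle y))
      exact Ideal.Quotient.eq.2 (Ideal.pow_right_mono h m this))

/-- If `M` is torsion with respect to a finite intersection of maximal ideals, then its
localization at any maximal ideal `𝔪` is `𝔪`-torsion. -/
theorem isTorsionModule_localization {R : Type*} [CommRing R] {𝔠 : Ideal R}
    {𝒞 : Finset (MaximalSpectrum R)} (h𝔠 : 𝔠 = ⨅ 𝔪 ∈ 𝒞, 𝔪.asIdeal)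
    {M : Type*} [AddCommGroup M] [Module R M] (hM : IsTorsionModule 𝔠 M) (𝔪 : MaximalSpectrum R) :
    IsTorsionModule 𝔪.asIdeal (LocalizedModule.AtPrime 𝔪.asIdeal M) := by
  classical
  have hs : ∃ s, s ∉ 𝔪.asIdeal ∧ ∀ a ∈ 𝔪.asIdeal, s * a ∈ 𝔠 := by
    have : ¬ (𝒞.erase 𝔪).inf MaximalSpectrum.asIdeal ≤ 𝔪.asIdeal := by
      intro hle
      obtain ⟨𝔫, h𝔫, hle'⟩ := (Ideal.IsPrime.inf_le' 𝔪.isMaximal.isPrime).1 hle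
      exact (Finset.mem_erase.1 h𝔫).1
        (MaximalSpectrum.ext (𝔫.isMaximal.eq_of_le 𝔪.isMaximal.ne_top hle'))
    obtain ⟨s, hs, hs'⟩ := Set.not_subset.1 this
    refine ⟨s, hs', fun a ha => ?_⟩
    rw [h𝔠]
    simp only [Ideal.mem_iInf]
    intro 𝔫 h𝔫
    by_cases h : 𝔫 = 𝔪
    · subst h; exact Ideal.mul_mem_left _ _ ha
    · have := Finset.inf_le (f := MaximalSpectrum.asIdeal) (Finset.mem_erase.2 ⟨h, h𝔫⟩) hs
      exact Ideal.mul_mem_right _ _ this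
  obtain ⟨s, hs, hs'⟩ := hs
  refine isTorsionModule_of_exists_pow fun x => ?_
  induction x using LocalizedModule.induction_on with
  | h x t =>
    obtain ⟨n, hn⟩ := hM.exists_pow x
    refine ⟨n, fun a ha => ?_⟩
    have hsn : ∀ k : ℕ, ∀ a ∈ 𝔪.asIdeal ^ k, s ^ k * a ∈ 𝔠 ^ k := by
      intro k
      have : Ideal.span {s ^ k} * 𝔪.asIdeal ^ k ≤ 𝔠 ^ k := by
        rw [← Ideal.span_singleton_pow, ← mul_pow]
        exact Ideal.pow_right_mono (Ideal.span_singleton_mul_le_iff.2 hs') k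
      exact fun a ha => Ideal.span_singleton_mul_le_iff.1 this a ha
    rw [LocalizedModule.smul'_mk, ← LocalizedModule.zero_mk t, LocalizedModule.mk_eq]
    refine ⟨⟨s, hs⟩ ^ n, ?_⟩
    have h0 : s ^ n • a • x = 0 := by rw [smul_smul]; exact hn _ (hsn n a ha)
    rw [smul_comm _ t (a • x), smul_zero, smul_zero,
      show (⟨s, hs⟩ ^ n : 𝔪.asIdeal.primeCompl) • a • x = s ^ n • a • x from rfl, h0, smul_zero]

section ExtModules

variable {A : Type u} [CommRing A]

/-- If a commutative ring `S` acts on the `A`-module `M` by `A`-linear endomorphisms, then it acts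
on `Ext^i_A(M, Y)` by functoriality in the first variable. -/
@[reducible]
def extModuleOfAction {S : Type*} [CommRing S] {M : Type u} [AddCommGroup M] [Module A M]
    (ρ : S →+* Module.End A M) (Y : ModuleCat.{u} A) (i : ℕ) :
    Module S (Ext.{u} (ModuleCat.of A M) Y i) where
  smul s e := (Ext.mk₀ (ModuleCat.ofHom (ρ s))).comp e (zero_add i)
  one_smul e := by
    change (Ext.mk₀ (ModuleCat.ofHom (ρ 1))).comp e (zero_add i) = e
    rw [map_one]
    exact Ext.mk₀_id_comp e
  mul_smul s t e := by
    change (Ext.mk₀ (ModuleCat.ofHom (ρ (s * t)))).comp e (zero_add i) =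
      (Ext.mk₀ (ModuleCat.ofHom (ρ s))).comp
        ((Ext.mk₀ (ModuleCat.ofHom (ρ t))).comp e (zero_add i)) (zero_add i)
    rw [mul_comm s t, map_mul, Ext.mk₀_comp_mk₀_assoc]
    rfl
  smul_zero s := Ext.comp_zero _ _ _ _ _
  smul_add s e f := Ext.comp_add _ _ _ _
  add_smul s t e := by
    change (Ext.mk₀ (ModuleCat.ofHom (ρ (s + t)))).comp e (zero_add i) = _
    rw [map_add]
    have : ModuleCat.ofHom (ρ s + ρ t) = ModuleCat.ofHom (ρ s) + ModuleCat.ofHom (ρ t) := rfl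
    rw [this, Ext.mk₀_add, Ext.add_comp]
    rfl
  zero_smul e := by
    change (Ext.mk₀ (ModuleCat.ofHom (ρ 0))).comp e (zero_add i) = 0
    rw [map_zero]
    have : ModuleCat.ofHom (0 : Module.End A M) = 0 := rfl
    rw [this, Ext.mk₀_zero, Ext.zero_comp]

end ExtModules

section

variable {R : Type u} [CommRing R] (𝔪 : MaximalSpectrum R)
  (T L : Type u) [AddCommGroup T] [Module R T] [AddCommGroup L] [Module R L] (i : ℕ)

/-- `Ext^i` over the `𝔪`-adic completion `S` of `R`, of `Γ_𝔪(T)` and `S ⊗[R] L`. -/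
def ExtCompletion : Type u :=
  Ext.{u}
    (ModuleCat.of (AdicCompletion 𝔪.asIdeal R) (Ideal.primaryComponent T 𝔪.asIdeal))
    (ModuleCat.of (AdicCompletion 𝔪.asIdeal R) (AdicCompletion 𝔪.asIdeal R ⊗[R] L)) i

instance : AddCommGroup (ExtCompletion 𝔪 T L i) :=
  inferInstanceAs (AddCommGroup (Ext.{u} _ _ i))

/-- The usual module structure of `Ext` over a commutative ring. -/
instance : Module (AdicCompletion 𝔪.asIdeal R) (ExtCompletion 𝔪 T L i) :=
  inferInstanceAs (Module (AdicCompletion 𝔪.asIdeal R) (Ext.{u} (ModuleCat.of _ _) _ i))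

/-- Restriction of scalars along `R → S`. -/
instance : Module R (ExtCompletion 𝔪 T L i) :=
  Module.compHom _ (algebraMap R (AdicCompletion 𝔪.asIdeal R))

/-- Restriction of scalars along the map from the `𝔞`-adic completion, when `𝔞 ⊆ 𝔪`. -/
@[reducible]
def ExtCompletion.module {𝔞 : Ideal R} (h : 𝔞 ≤ 𝔪.asIdeal) :
    Module (AdicCompletion 𝔞 R) (ExtCompletion 𝔪 T L i) :=
  Module.compHom _ (completionMap h : AdicCompletion 𝔞 R →+* AdicCompletion 𝔪.asIdeal R)

/-- `Ext^i` over `R_𝔪` of `T_𝔪` and `L_𝔪`. -/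
def ExtLocalization : Type u :=
  Ext.{u}
    (ModuleCat.of (Localization.AtPrime 𝔪.asIdeal) (LocalizedModule.AtPrime 𝔪.asIdeal T))
    (ModuleCat.of (Localization.AtPrime 𝔪.asIdeal) (LocalizedModule.AtPrime 𝔪.asIdeal L)) i

instance : AddCommGroup (ExtLocalization 𝔪 T L i) :=
  inferInstanceAs (AddCommGroup (Ext.{u} _ _ i))

/-- The usual module structure of `Ext` over a commutative ring. -/
instance : Module (Localization.AtPrime 𝔪.asIdeal) (ExtLocalization 𝔪 T L i) :=
  inferInstanceAs (Module (Localization.AtPrime 𝔪.asIdeal) (Ext.{u} (ModuleCat.of _ _) _ i))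

/-- Restriction of scalars along `R → R_𝔪`. -/
instance : Module R (ExtLocalization 𝔪 T L i) :=
  Module.compHom _ (algebraMap R (Localization.AtPrime 𝔪.asIdeal))

variable {𝔪 T} in
/-- When `T_𝔪` is `𝔪`-torsion, it is a module over the `𝔪`-adic completion of `R`, and so is
`Ext^i_{R_𝔪}(T_𝔪, L_𝔪)`; restrict scalars to the `𝔞`-adic completion for `𝔞 ⊆ 𝔪`. -/
@[reducible]
def ExtLocalization.module (hT : IsTorsionModule 𝔪.asIdeal (LocalizedModule.AtPrime 𝔪.asIdeal T))
    {𝔞 : Ideal R} (h : 𝔞 ≤ 𝔪.asIdeal) : Module (AdicCompletion 𝔞 R) (ExtLocalization 𝔪 T L i) :=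
  extModuleOfAction
    ((completionAction (Localization.AtPrime 𝔪.asIdeal) hT).comp
      (completionMap h : AdicCompletion 𝔞 R →+* AdicCompletion 𝔪.asIdeal R))
    (ModuleCat.of (Localization.AtPrime 𝔪.asIdeal) (LocalizedModule.AtPrime 𝔪.asIdeal L)) i

end

end TorsionExt

end

/-! Write `S` for either the `𝔪`-adic completion of `R` or the localization `R_𝔪`. Both are flat
over `R`, and modulo every power of `𝔪` each element of `S` is represented by an element of `R`,
while `𝔪S` is proper (`IsDenseAt`). This is all the comparison of Ext groups needs. For an
`S`-module `X` that is `𝔪`-torsion over `R`, consider `Ext_S(X, S ⊗ L) → Ext_R(X, S ⊗ L) ← Ext_R(X,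
L)`.

In degree 0 the left map is bijective because `R`-linear maps out of `X` are automatically
`S`-linear, and the right one because `L` and `S ⊗ L` have the same `𝔪`-power torsion
(`comp_mk_bijective`). Higher degrees follow by dimension shifting, since the functors involved are
exact and preserve injectives: restriction of scalars because its left adjoint is exact, and `S ⊗ -`
because `R` is noetherian (`baer_tensorProduct`). The result is `extBaseChangeEquiv`.

Since `T` is `𝔠`-torsion, it is a finite direct sum of its submodules `Γ_𝔪(T)`, and `Γ_𝔪(T) ≅ T_𝔪`.
Hence `Ext_R(T, L)` splits into the groups `Ext_R(Γ_𝔪(T), L)`, each of which is compared with both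
choices of `S`. The localized form shows that the summand at `𝔪` vanishes unless `𝔪` lies in both
supports, so only `𝒢` matters.

For linearity, every action in sight is precomposition with an endomorphism of the first variable.
The comparison maps are natural in that variable, and any `R`-linear map between `𝔪`-torsion modules
commutes with the action of the completion (`map_completionSMul`). -/

noncomputable section

namespace TorsionExt

open Limits

/-! ### Dimension shifting for exact functors preserving injectives -/

section Categorical

universe w w' v v' u₁ u₂

variable {C : Type u₁} [Category.{v} C] [Abelian C] {D : Type u₂} [Category.{v'} D] [Abelian D]

attribute [local instance] Ext.subsingleton_of_injective in
/-- An exact functor preserving injective objects induces bijections on `Ext(X, -)` as soon as it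
induces bijections on `Hom(X, -)`. -/
theorem mapExtAddHom_bijective [HasExt.{w} C] [HasExt.{w'} D] [EnoughInjectives C]
    (F : C ⥤ D) [F.Additive] [PreservesFiniteLimits F] [PreservesFiniteColimits F]
    [F.PreservesInjectiveObjects] (X : C)
    (hX : ∀ Y : C, Function.Bijective (F.map : (X ⟶ Y) → (F.obj X ⟶ F.obj Y)))
    (Y : C) (n : ℕ) : Function.Bijective (F.mapExtAddHom X Y n) := by
  induction n generalizing Y with
  | zero => simpa [Ext.mapExactFunctor₀] using hX Y
  | succ n hn =>
    -- Embed `Y` in an injective object, with quotient `Q`. Both Ext groups of degree `n + 1` into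
    -- the injective and into its image vanish, so `Ext^{n+1}(X, Y)` is the cokernel of `Ext^n(X, I)
    -- → Ext^n(X, Q)`, also when `n = 0`. The same holds after applying `F`, and the induction
    -- hypothesis compares the cokernels.
    let I : InjectivePresentation Y := Classical.arbitrary _
    let S := ShortComplex.mk _ _ (cokernel.condition I.f)
    have : Injective (S.map F).X₂ := Functor.PreservesInjectiveObjects.injective_obj I.injective
    have hS : S.ShortExact := { exact := ShortComplex.exact_cokernel I.f }
    refine AddMonoidHom.bijective_of_surjective_of_bijective_of_right_exact _ _ _ _
      (F.mapExtAddHom X S.X₂ n) (F.mapExtAddHom X S.X₃ n) (F.mapExtAddHom X S.X₁ (n + 1))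
      ?_ ?_
      ((ShortComplex.ab_exact_iff_function_exact _).mp
        (Ext.covariant_sequence_exact₃' X hS n (n + 1) rfl))
      ((ShortComplex.ab_exact_iff_function_exact _).mp
        (Ext.covariant_sequence_exact₃' (F.obj X) (hS.map F) n (n + 1) rfl))
      (hn _).surjective (hn _)
      (fun x₁ ↦ Ext.covariant_sequence_exact₁ _ hS x₁ (by subsingleton) rfl)
      (fun y₁ ↦ Ext.covariant_sequence_exact₁ _ (hS.map F) y₁ (by subsingleton) rfl)
    · ext x
      refine Eq.trans ?_ (Ext.mapExactFunctor_comp F x (Ext.mk₀ S.g) (add_zero n)).symm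
      rw [Ext.mapExactFunctor_mk₀]
      rfl
    · ext x
      refine Eq.trans ?_ (Ext.mapExactFunctor_comp F x hS.extClass rfl).symm
      rw [Ext.mapExactFunctor_extClass]
      rfl

attribute [local instance] Ext.subsingleton_of_injective in
/-- If `η : 𝟭 ⟶ F` is a natural transformation to an exact functor preserving injective objects and
`Hom(X, Y) → Hom(X, F Y)` is bijective for all `Y`, then so is `Ext(X, Y) → Ext(X, F Y)`. -/
theorem postcomp_natTrans_bijective [HasExt.{w} C] [EnoughInjectives C]
    {F : C ⥤ C} [F.Additive] [PreservesFiniteLimits F] [PreservesFiniteColimits F]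
    [F.PreservesInjectiveObjects] (η : 𝟭 C ⟶ F) (X : C)
    (hX : ∀ Y : C, Function.Bijective (fun f : X ⟶ Y ↦ f ≫ η.app Y))
    (Y : C) (n : ℕ) :
    Function.Bijective ((Ext.mk₀ (η.app Y)).postcomp X (add_zero n)) := by
  induction n generalizing Y with
  | zero =>
    have h : ((Ext.mk₀ (η.app Y)).postcomp X (add_zero 0)) ∘ Ext.addEquiv₀.symm =
        Ext.addEquiv₀.symm ∘ (fun f : X ⟶ Y ↦ f ≫ η.app Y) := by
      ext f
      exact Ext.mk₀_comp_mk₀ _ _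
    rw [← Function.Bijective.of_comp_iff _ (Ext.addEquiv₀ (X := X) (Y := Y)).symm.bijective, h]
    exact (Ext.addEquiv₀ (X := X) (Y := F.obj Y)).symm.bijective.comp (hX Y)
  | succ n hn =>
    let I : InjectivePresentation Y := Classical.arbitrary _
    let S := ShortComplex.mk _ _ (cokernel.condition I.f)
    have : Injective (S.map F).X₂ := Functor.PreservesInjectiveObjects.injective_obj I.injective
    have hS : S.ShortExact := { exact := ShortComplex.exact_cokernel I.f }
    -- As a morphism of short exact sequences, `η` is compatible with the extension classes; this
    -- gives the square containing the connecting maps.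
    let φ : S ⟶ S.map F :=
      { τ₁ := η.app S.X₁
        τ₂ := η.app S.X₂
        τ₃ := η.app S.X₃
        comm₁₂ := (η.naturality S.f).symm
        comm₂₃ := (η.naturality S.g).symm }
    refine AddMonoidHom.bijective_of_surjective_of_bijective_of_right_exact _ _ _ _
      ((Ext.mk₀ (η.app S.X₂)).postcomp X (add_zero n))
      ((Ext.mk₀ (η.app S.X₃)).postcomp X (add_zero n))
      ((Ext.mk₀ (η.app S.X₁)).postcomp X (add_zero (n + 1)))
      ?_ ?_
      ((ShortComplex.ab_exact_iff_function_exact _).mp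
        (Ext.covariant_sequence_exact₃' X hS n (n + 1) rfl))
      ((ShortComplex.ab_exact_iff_function_exact _).mp
        (Ext.covariant_sequence_exact₃' X (hS.map F) n (n + 1) rfl))
      (hn _).surjective (hn _)
      (fun x₁ ↦ Ext.covariant_sequence_exact₁ _ hS x₁ (by subsingleton) rfl)
      (fun y₁ ↦ Ext.covariant_sequence_exact₁ _ (hS.map F) y₁ (by subsingleton) rfl)
    · ext x
      have := η.naturality S.g
      simp only [Functor.id_map] at this
      change (x.comp (Ext.mk₀ (η.app S.X₂)) (add_zero n)).comp (Ext.mk₀ (F.map S.g)) (add_zero n) =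
        (x.comp (Ext.mk₀ S.g) (add_zero n)).comp (Ext.mk₀ (η.app S.X₃)) (add_zero n)
      simp only [Ext.comp_assoc_of_second_deg_zero, Ext.mk₀_comp_mk₀, this]
    · ext x
      have := ShortComplex.ShortExact.extClass_naturality hS (hS.map F) φ
      change (x.comp (Ext.mk₀ φ.τ₃) (add_zero n)).comp (hS.map F).extClass rfl =
        (x.comp hS.extClass rfl).comp (Ext.mk₀ φ.τ₁) (add_zero (n + 1))
      rw [Ext.comp_assoc_of_second_deg_zero, ← this, Ext.comp_assoc_of_third_deg_zero]

end Categorical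

end TorsionExt

namespace TorsionExt

/-! ### Torsion modules and flat algebras dense at a maximal ideal -/

section Algebra

variable {R : Type*} [CommRing R]

/-- `S` has the same residue rings as `R` along the powers of the ideal `I`: every element of `S`
is congruent modulo `Iⁿ S` to an element of `R`, and `I S` is a proper ideal. -/
structure IsDenseAt (I : Ideal R) (S : Type*) [CommRing S] [Algebra R S] : Prop where
  exists_sub_mem : ∀ (n : ℕ) (s : S), ∃ r : R,
    s - algebraMap R S r ∈ (I ^ n).map (algebraMap R S)
  map_ne_top : I.map (algebraMap R S) ≠ ⊤

variable {S : Type*} [CommRing S] [Algebra R S]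

/-- If `Iⁿ` kills `x`, so does its extension to `S`. -/
theorem smul_eq_zero_of_mem_map {M : Type*} [AddCommGroup M] [Module R M] [Module S M]
    [IsScalarTower R S M] {J : Ideal R} {x : M} (hx : ∀ a ∈ J, a • x = 0) {s : S}
    (hs : s ∈ J.map (algebraMap R S)) : s • x = 0 := by
  have h : J.map (algebraMap R S) ≤ LinearMap.ker (LinearMap.toSpanSingleton S M x) := by
    refine Ideal.map_le_iff_le_comap.2 fun a ha => ?_
    change algebraMap R S a • x = 0
    rw [algebraMap_smul, hx a ha]
  exact h hs

theorem IsDenseAt.exists_smul_eq {I : Ideal R} (hS : IsDenseAt I S) {M : Type*} [AddCommGroup M]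
    [Module R M] [Module S M] [IsScalarTower R S M] (n : ℕ) (s : S) :
    ∃ r : R, ∀ x : M, (∀ a ∈ I ^ n, a • x = 0) → s • x = r • x := by
  obtain ⟨r, hr⟩ := hS.exists_sub_mem n s
  refine ⟨r, fun x hx => ?_⟩
  have := smul_eq_zero_of_mem_map hx hr
  rwa [sub_smul, algebraMap_smul, sub_eq_zero] at this

variable {I : Ideal R}

/-- If `x ≠ 0`, its annihilator `J` lies in a maximal ideal; this contains `Iⁿ`, so it is `I`. By
flatness `S ⊗ J → S → S ⊗ L` is exact, so `1 ⊗ x = 0` puts 1 in `JS ⊆ IS`, which is proper. -/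
theorem one_tmul_eq_zero [Module.Flat R S] (hI : I.IsMaximal) (hS : IsDenseAt I S) {L : Type*}
    [AddCommGroup L] [Module R L] {n : ℕ} {x : L} (hx : ∀ a ∈ I ^ n, a • x = 0)
    (h : (1 : S) ⊗ₜ[R] x = 0) : x = 0 := by
  by_contra hx0
  let J : Ideal R := LinearMap.ker (LinearMap.toSpanSingleton R L x)
  have hJ : J ≠ ⊤ := fun h => hx0 <| by
    have : (1 : R) ∈ J := h ▸ Submodule.mem_top
    simpa [J] using this
  obtain ⟨P, hP, hJP⟩ := Ideal.exists_le_maximal J hJ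
  have hIP : I = P := hI.eq_of_le hP.ne_top
    (hP.isPrime.le_of_pow_le (n := n) fun a ha => hJP (show a • x = 0 from hx a ha))
  have hex : Function.Exact J.subtype (LinearMap.toSpanSingleton R L x) :=
    LinearMap.exact_subtype_ker_map _
  obtain ⟨z, hz⟩ := (Module.Flat.lTensor_exact S hex ((1 : S) ⊗ₜ[R] (1 : R))).1 (by simpa using h)
  have key : ∀ z : S ⊗[R] J, TensorProduct.rid R S (LinearMap.lTensor S J.subtype z) ∈
      I.map (algebraMap R S) := by
    intro z
    induction z with
    | zero => simp
    | add a b ha hb => rw [map_add, map_add]; exact add_mem ha hb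
    | tmul s a =>
      rw [LinearMap.lTensor_tmul, TensorProduct.rid_tmul, Algebra.smul_def]
      exact Ideal.mul_mem_right _ _ (Ideal.mem_map_of_mem _ (hIP ▸ hJP a.2))
  refine hS.map_ne_top ((Ideal.eq_top_iff_one _).2 ?_)
  have := key z
  rw [hz] at this
  simpa using this

/-- The element `y` is a map `R ⧸ Iⁿ → S ⊗ L`. As `R ⧸ Iⁿ` is finitely presented and `S` is flat,
such maps are `S`-combinations of maps `R ⧸ Iⁿ → L`, and density replaces the coefficients by
elements of `R`. -/
theorem exists_one_tmul_eq [IsNoetherianRing R] [Module.Flat R S] (hS : IsDenseAt I S)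
    {L : Type*} [AddCommGroup L] [Module R L] {n : ℕ} {y : S ⊗[R] L}
    (hy : ∀ a ∈ I ^ n, a • y = 0) :
    ∃ x : L, (∀ a ∈ I ^ n, a • x = 0) ∧ (1 : S) ⊗ₜ[R] x = y := by
  have := Module.finitePresentation_of_finite R (R ⧸ I ^ n)
  have hb := Module.FinitePresentation.isBaseChange_map R (R ⧸ I ^ n) L S
  let g : (R ⧸ I ^ n) →ₗ[R] S ⊗[R] L :=
    (I ^ n).liftQ (LinearMap.toSpanSingleton R _ y) fun a ha => hy a ha
  let g' : S ⊗[R] (R ⧸ I ^ n) →ₗ[S] S ⊗[R] L := (TensorProduct.isBaseChange R _ S).lift g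
  have hg' : g' (1 ⊗ₜ 1) = y := by
    have h1 : g' (1 ⊗ₜ 1) = g 1 := (TensorProduct.isBaseChange R _ S).lift_eq g 1
    rw [h1]
    exact (Submodule.liftQ_apply _ _ (1 : R)).trans (one_smul _ _)
  have key : ∀ f : S ⊗[R] (R ⧸ I ^ n) →ₗ[S] S ⊗[R] L,
      ∃ x : L, (∀ a ∈ I ^ n, a • x = 0) ∧ (1 : S) ⊗ₜ[R] x = f (1 ⊗ₜ 1) := by
    intro f
    induction f using hb.inductionOn with
    | zero => exact ⟨0, by simp, by simp⟩
    | tmul f =>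
      refine ⟨f 1, fun a ha => ?_, by simp⟩
      rw [← map_smul, show a • (1 : R ⧸ I ^ n) = 0 from ?_, map_zero]
      rw [← map_one (Ideal.Quotient.mk (I ^ n)), ← Ideal.Quotient.mk_eq_mk,
        ← Submodule.Quotient.mk_smul]
      exact (Submodule.Quotient.mk_eq_zero _).2 (by simpa using ha)
    | smul s f hf =>
      obtain ⟨x, hx, hxf⟩ := hf
      obtain ⟨r, hr⟩ := hS.exists_smul_eq (M := S ⊗[R] L) n s
      refine ⟨r • x, fun a ha => by rw [smul_comm, hx a ha, smul_zero], ?_⟩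
      rw [LinearMap.smul_apply, ← hxf, hr _ fun a ha => by
        rw [← TensorProduct.tmul_smul, hx a ha, TensorProduct.tmul_zero], TensorProduct.tmul_smul]
    | add f₁ f₂ h₁ h₂ =>
      obtain ⟨x₁, hx₁, h₁⟩ := h₁
      obtain ⟨x₂, hx₂, h₂⟩ := h₂
      exact ⟨x₁ + x₂, fun a ha => by rw [smul_add, hx₁ a ha, hx₂ a ha, add_zero],
        by rw [TensorProduct.tmul_add, h₁, h₂, LinearMap.add_apply]⟩
  obtain ⟨x, hx, h⟩ := key g'
  exact ⟨x, hx, h.trans hg'⟩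

/-- A linear map out of an `I`-torsion module to `S ⊗ L` factors uniquely through `L`. -/
theorem comp_mk_bijective [IsNoetherianRing R] [Module.Flat R S] (hI : I.IsMaximal)
    (hS : IsDenseAt I S) {T : Type*} [AddCommGroup T] [Module R T] (hT : IsTorsionModule I T)
    (L : Type*) [AddCommGroup L] [Module R L] :
    Function.Bijective (fun f : T →ₗ[R] L => (TensorProduct.mk R S L 1).comp f) := by
  have hinj : ∀ f : T →ₗ[R] L, (TensorProduct.mk R S L 1).comp f = 0 → f = 0 := by
    intro f hf
    ext x
    obtain ⟨n, hn⟩ := hT.exists_pow x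
    exact one_tmul_eq_zero hI hS (n := n) (fun a ha => by rw [← map_smul, hn a ha, map_zero])
      (LinearMap.congr_fun hf x)
  refine ⟨fun f g h => sub_eq_zero.1 (hinj _ ?_), fun g => ?_⟩
  · rw [LinearMap.comp_sub]
    exact sub_eq_zero.2 h
  -- Preimages are chosen elementwise inside the `I`-power torsion of `L`, where they are unique;
  -- uniqueness makes the choice linear.
  have huniq : ∀ x y : L, (∃ n, ∀ a ∈ I ^ n, a • x = 0) → (∃ n, ∀ a ∈ I ^ n, a • y = 0) →
      (1 : S) ⊗ₜ[R] x = 1 ⊗ₜ[R] y → x = y := by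
    rintro x y ⟨n, hn⟩ ⟨k, hk⟩ h
    refine sub_eq_zero.1 (one_tmul_eq_zero hI hS (n := max n k) (fun a ha => ?_) ?_)
    · rw [smul_sub, hn a (Ideal.pow_le_pow_right (le_max_left _ _) ha),
        hk a (Ideal.pow_le_pow_right (le_max_right _ _) ha), sub_zero]
    · rw [TensorProduct.tmul_sub, h, sub_self]
  have hex : ∀ t : T, ∃ x : L, (∃ n, ∀ a ∈ I ^ n, a • x = 0) ∧ (1 : S) ⊗ₜ[R] x = g t := by
    intro t
    obtain ⟨n, hn⟩ := hT.exists_pow t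
    obtain ⟨x, hx, h⟩ := exists_one_tmul_eq hS (n := n) (y := g t)
      fun a ha => by rw [← map_smul, hn a ha, map_zero]
    exact ⟨x, ⟨n, hx⟩, h⟩
  choose f hf hfg using hex
  refine ⟨⟨⟨f, fun t u => ?_⟩, fun r t => ?_⟩, LinearMap.ext hfg⟩
  · refine huniq _ _ (hf _) ?_ ?_
    · obtain ⟨n, hn⟩ := hf t
      obtain ⟨k, hk⟩ := hf u
      exact ⟨max n k, fun a ha => by
        rw [smul_add, hn a (Ideal.pow_le_pow_right (le_max_left _ _) ha),
          hk a (Ideal.pow_le_pow_right (le_max_right _ _) ha), add_zero]⟩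
    · rw [TensorProduct.tmul_add, hfg, hfg, hfg, map_add]
  · refine huniq _ _ (hf _) ?_ ?_
    · obtain ⟨n, hn⟩ := hf t
      exact ⟨n, fun a ha => by rw [RingHom.id_apply, smul_comm, hn a ha, smul_zero]⟩
    · rw [hfg, RingHom.id_apply, TensorProduct.tmul_smul, hfg, map_smul]

/-- `R`-linear maps out of an `I`-torsion `S`-module are `S`-linear. -/
theorem IsDenseAt.map_smul (hS : IsDenseAt I S) {X M : Type*} [AddCommGroup X] [AddCommGroup M]
    [Module R X] [Module S X] [IsScalarTower R S X] [Module R M] [Module S M]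
    [IsScalarTower R S M] (hX : IsTorsionModule I X) (f : X →ₗ[R] M) (s : S) (x : X) :
    f (s • x) = s • f x := by
  obtain ⟨n, hn⟩ := hX.exists_pow x
  obtain ⟨r, hr⟩ := hS.exists_sub_mem n s
  have h₁ := smul_eq_zero_of_mem_map hn hr
  have h₂ := smul_eq_zero_of_mem_map (x := f x)
    (fun a ha => by rw [← LinearMap.map_smul, hn a ha, map_zero]) hr
  rw [sub_smul, algebraMap_smul, sub_eq_zero] at h₁ h₂
  rw [h₁, h₂, LinearMap.map_smul]

/-- Over a noetherian ring, `S ⊗ E` is injective if `S` is flat and `E` is injective. -/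
theorem baer_tensorProduct [IsNoetherianRing R] [Module.Flat R S] {E : Type*} [AddCommGroup E]
    [Module R E] (hE : Module.Baer R E) : Module.Baer R (S ⊗[R] E) := by
  intro J g
  have := Module.finitePresentation_of_finite R J
  have hb := Module.FinitePresentation.isBaseChange_map R J E S
  -- Since `J` is finitely presented, maps `J → S ⊗ E` are `S`-combinations of maps `J → E`, and
  -- each of these extends to `R`.
  have key : ∀ f : S ⊗[R] J →ₗ[S] S ⊗[R] E,
      ∃ g' : R →ₗ[R] S ⊗[R] E, ∀ (x : R) (hx : x ∈ J), g' x = f (1 ⊗ₜ ⟨x, hx⟩) := by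
    intro f
    induction f using hb.inductionOn with
    | zero => exact ⟨0, by simp⟩
    | tmul f =>
      obtain ⟨f', hf'⟩ := hE J f
      exact ⟨(TensorProduct.mk R S E 1).comp f', fun x hx => by simp [hf' x hx]⟩
    | smul s f hf =>
      obtain ⟨f', hf'⟩ := hf
      exact ⟨s • f', fun x hx => by simp [hf' x hx]⟩
    | add f₁ f₂ h₁ h₂ =>
      obtain ⟨f₁', h₁⟩ := h₁
      obtain ⟨f₂', h₂⟩ := h₂
      exact ⟨f₁' + f₂', fun x hx => by simp [h₁ x hx, h₂ x hx]⟩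
  obtain ⟨g', hg'⟩ := key ((TensorProduct.isBaseChange R _ S).lift g)
  exact ⟨g', fun x hx => (hg' x hx).trans ((TensorProduct.isBaseChange R _ S).lift_eq g _)⟩

end Algebra

end TorsionExt

namespace TorsionExt

open Limits MonoidalCategory

/-! ### Isomorphisms in either variable of Ext -/

section ExtIso

universe w v u₁

variable {C : Type u₁} [Category.{v} C] [Abelian C] [HasExt.{w} C]

theorem precomp_iso_bijective {X Y : C} (e : X ≅ Y) (Z : C) (n : ℕ) :
    Function.Bijective ((Ext.mk₀ e.hom).precomp Z (zero_add n)) := by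
  refine Function.bijective_iff_has_inverse.2 ⟨(Ext.mk₀ e.inv).precomp Z (zero_add n),
    fun x => ?_, fun x => ?_⟩
  · exact (Ext.mk₀_comp_mk₀_assoc _ _ _).trans (by rw [e.inv_hom_id, Ext.mk₀_id_comp])
  · exact (Ext.mk₀_comp_mk₀_assoc _ _ _).trans (by rw [e.hom_inv_id, Ext.mk₀_id_comp])

theorem postcomp_iso_bijective {X Y : C} (e : X ≅ Y) (Z : C) (n : ℕ) :
    Function.Bijective ((Ext.mk₀ e.hom).postcomp Z (add_zero n)) := by
  refine Function.bijective_iff_has_inverse.2 ⟨(Ext.mk₀ e.inv).postcomp Z (add_zero n),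
    fun x => ?_, fun x => ?_⟩
  · refine (Ext.comp_assoc_of_third_deg_zero _ _ _ (add_zero n)).trans ?_
    rw [Ext.mk₀_comp_mk₀, e.hom_inv_id, Ext.comp_mk₀_id]
  · refine (Ext.comp_assoc_of_third_deg_zero _ _ _ (add_zero n)).trans ?_
    rw [Ext.mk₀_comp_mk₀, e.inv_hom_id, Ext.comp_mk₀_id]

end ExtIso

/-! ### Comparing Ext over `S` with Ext over `R` -/

section BaseChange

variable {R S : Type u} [CommRing R] [CommRing S] [Algebra R S] {I : Ideal R}

/-- The natural map from a module to its base change, as a natural transformation. -/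
def unitTensorLeft (R S : Type u) [CommRing R] [CommRing S] [Algebra R S] :
    𝟭 (ModuleCat.{u} R) ⟶ tensorLeft (ModuleCat.of R S) where
  app L := ModuleCat.ofHom (TensorProduct.mk R S L 1)

theorem tensorLeft_preservesInjectiveObjects [IsNoetherianRing R] [Module.Flat R S] :
    (tensorLeft (ModuleCat.of R S)).PreservesInjectiveObjects where
  injective_obj {E} hE := by
    have h := Module.Baer.of_injective ((Module.injective_iff_injective_object R E).2 hE)
    exact (Module.injective_iff_injective_object R (S ⊗[R] E)).1
      (baer_tensorProduct (S := S) h).injective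

attribute [local instance] tensorLeft_preservesInjectiveObjects in
/-- For an `I`-torsion module `T` and a base change `j : L → M` along a flat `R`-algebra which is
dense at the maximal ideal `I`, the map `Ext_R(T, L) → Ext_R(T, M)` is bijective. -/
theorem postcomp_baseChange_bijective [IsNoetherianRing R] [Module.Flat R S] (hI : I.IsMaximal)
    (hS : IsDenseAt I S) {T : Type u} [AddCommGroup T] [Module R T] (hT : IsTorsionModule I T)
    {L M : Type u} [AddCommGroup L] [Module R L] [AddCommGroup M] [Module R M] [Module S M]
    [IsScalarTower R S M] {j : L →ₗ[R] M} (hj : IsBaseChange S j) (i : ℕ) :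
    Function.Bijective
      ((Ext.mk₀ (ModuleCat.ofHom j)).postcomp (ModuleCat.of R T) (add_zero i)) := by
  have h₁ := postcomp_natTrans_bijective (unitTensorLeft R S) (ModuleCat.of R T)
    (fun Y => by
      have h := comp_mk_bijective hI hS hT Y
      refine ⟨fun f g hfg => ModuleCat.hom_ext (h.1 ?_), fun g => ?_⟩
      · exact congrArg ModuleCat.Hom.hom hfg
      · obtain ⟨f, hf⟩ := h.2 g.hom
        exact ⟨ModuleCat.ofHom f, ModuleCat.hom_ext hf⟩) (ModuleCat.of R L) i
  let e : ModuleCat.of R (S ⊗[R] L) ≅ ModuleCat.of R M :=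
    (hj.equiv.restrictScalars R).toModuleIso
  have h₂ := postcomp_iso_bijective e (ModuleCat.of R T) i
  have h₃ : ModuleCat.ofHom j = (unitTensorLeft R S).app (ModuleCat.of R L) ≫ e.hom := by
    ext x
    exact ((hj.equiv_tmul 1 x).trans (one_smul _ _)).symm
  have h : ⇑((Ext.mk₀ (ModuleCat.ofHom j)).postcomp (ModuleCat.of R T) (add_zero i)) =
      (Ext.mk₀ e.hom).postcomp (ModuleCat.of R T) (add_zero i) ∘
        (Ext.mk₀ ((unitTensorLeft R S).app (ModuleCat.of R L))).postcomp _ (add_zero i) := by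
    funext x
    rw [h₃, ← Ext.mk₀_comp_mk₀]
    exact (Ext.comp_assoc_of_third_deg_zero _ _ _ (add_zero i)).symm
  rw [h]
  exact h₂.comp h₁

variable {X M : Type u} [AddCommGroup X] [Module R X] [Module S X] [IsScalarTower R S X]
  [AddCommGroup M] [Module R M] [Module S M] [IsScalarTower R S M]

variable (R S X) in
/-- Restriction of scalars along `R → S` of an `S`-module which is already an `R`-module. -/
def restrictScalarsIso :
    (ModuleCat.restrictScalars.{u} (algebraMap R S)).obj (ModuleCat.of S X) ≅ ModuleCat.of R X :=
  LinearEquiv.toModuleIso <| @AddEquiv.toLinearEquiv _ _ _ _ _ _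
    ((ModuleCat.restrictScalars.{u} (algebraMap R S)).obj (ModuleCat.of S X)).isModule _
    (AddEquiv.refl X) fun r x => algebraMap_smul S r (show X from x)

variable (R S X M) in
/-- Restriction of scalars on `Ext`. -/
def restrictScalarsExt (i : ℕ) :
    Ext.{u} (ModuleCat.of S X) (ModuleCat.of S M) i →+
      Ext.{u} (ModuleCat.of R X) (ModuleCat.of R M) i :=
  (((Ext.mk₀ (restrictScalarsIso R S X).inv).precomp _ (zero_add i)).comp
    ((Ext.mk₀ (restrictScalarsIso R S M).hom).postcomp _ (add_zero i))).comp
    ((ModuleCat.restrictScalars.{u} (algebraMap R S)).mapExtAddHom _ _ i)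

theorem restrictScalarsExt_apply (i : ℕ) (x : Ext.{u} (ModuleCat.of S X) (ModuleCat.of S M) i) :
    restrictScalarsExt R S X M i x =
      (Ext.mk₀ (restrictScalarsIso R S X).inv).comp
        ((x.mapExactFunctor (ModuleCat.restrictScalars.{u} (algebraMap R S))).comp
          (Ext.mk₀ (restrictScalarsIso R S M).hom) (add_zero i)) (zero_add i) :=
  rfl

/-- Naturality in the first variable, through which all linearity statements pass. -/
theorem restrictScalarsExt_mk₀_comp {X' : Type u} [AddCommGroup X'] [Module R X'] [Module S X']
    [IsScalarTower R S X'] (φ : X →ₗ[S] X') (i : ℕ)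
    (x : Ext.{u} (ModuleCat.of S X') (ModuleCat.of S M) i) :
    restrictScalarsExt R S X M i ((Ext.mk₀ (ModuleCat.ofHom φ)).comp x (zero_add i)) =
      (Ext.mk₀ (ModuleCat.ofHom (φ.restrictScalars R))).comp (restrictScalarsExt R S X' M i x)
        (zero_add i) := by
  have h : (restrictScalarsIso R S X).inv ≫
      (ModuleCat.restrictScalars.{u} (algebraMap R S)).map (ModuleCat.ofHom φ) =
      ModuleCat.ofHom (φ.restrictScalars R) ≫ (restrictScalarsIso R S X').inv := rfl
  rw [restrictScalarsExt_apply, restrictScalarsExt_apply,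
    Ext.mapExactFunctor_comp _ _ _ (zero_add i), Ext.mapExactFunctor_mk₀,
    Ext.comp_assoc _ _ _ (zero_add i) (add_zero i) (by omega), Ext.mk₀_comp_mk₀_assoc, h,
    Ext.mk₀_comp_mk₀_assoc]

/-- Restriction of scalars along a flat `R`-algebra which is dense at `I` induces bijections
`Ext_S(X, M) → Ext_R(X, M)` when `X` is `I`-torsion. -/
theorem restrictScalarsExt_bijective [Module.Flat R S] (hS : IsDenseAt I S)
    (hX : IsTorsionModule I X) (i : ℕ) : Function.Bijective (restrictScalarsExt R S X M i) := by
  have hf : (algebraMap R S).Flat := RingHom.flat_algebraMap_iff.2 inferInstance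
  -- Flatness makes the left adjoint preserve monomorphisms, so restriction of scalars preserves
  -- injectives.
  have := ModuleCat.preservesFiniteLimits_extendScalars_of_flat hf
  have := Functor.preservesInjectiveObjects_of_adjunction_of_preservesMonomorphisms
    (ModuleCat.extendRestrictScalarsAdj.{u, u, u} (algebraMap R S))
  have h := mapExtAddHom_bijective (ModuleCat.restrictScalars.{u} (algebraMap R S))
    (ModuleCat.of S X) (fun Y => by
      refine ⟨(ModuleCat.restrictScalars.{u} (algebraMap R S)).map_injective, fun g => ?_⟩
      let _ : Module R Y := Module.compHom Y (algebraMap R S)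
      have : IsScalarTower R S Y := ⟨fun r s y => by
        rw [Algebra.smul_def, mul_smul]; rfl⟩
      let g' : X →ₗ[R] Y := ((restrictScalarsIso R S X).inv ≫ g).hom
      refine ⟨ModuleCat.ofHom { toFun := g', map_add' := map_add g', map_smul' := fun s x => ?_ },
        rfl⟩
      exact hS.map_smul hX g' s x) (ModuleCat.of S M) i
  exact ((precomp_iso_bijective (restrictScalarsIso R S X).symm _ i).comp
    (postcomp_iso_bijective (restrictScalarsIso R S M) _ i)).comp h

variable (X) in
/-- The isomorphism `Ext_S(X, M) ≅ Ext_R(X, L)` for an `S`-module `X` which is `I`-torsion and the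
base change `M` of `L` along a flat `R`-algebra `S` which is dense at the maximal ideal `I`. -/
def extBaseChangeEquiv [IsNoetherianRing R] [Module.Flat R S] (hI : I.IsMaximal)
    (hS : IsDenseAt I S) (hX : IsTorsionModule I X) {L : Type u} [AddCommGroup L] [Module R L]
    {j : L →ₗ[R] M} (hj : IsBaseChange S j) (i : ℕ) :
    Ext.{u} (ModuleCat.of S X) (ModuleCat.of S M) i ≃+
      Ext.{u} (ModuleCat.of R X) (ModuleCat.of R L) i :=
  (AddEquiv.ofBijective (restrictScalarsExt R S X M i) (restrictScalarsExt_bijective hS hX i)).trans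
    (AddEquiv.ofBijective _ (postcomp_baseChange_bijective hI hS hX hj i)).symm

theorem extBaseChangeEquiv_mk₀_comp [IsNoetherianRing R] [Module.Flat R S] (hI : I.IsMaximal)
    (hS : IsDenseAt I S) (hX : IsTorsionModule I X) {L : Type u} [AddCommGroup L] [Module R L]
    {j : L →ₗ[R] M} (hj : IsBaseChange S j) (i : ℕ) (φ : X →ₗ[S] X)
    (x : Ext.{u} (ModuleCat.of S X) (ModuleCat.of S M) i) :
    extBaseChangeEquiv X hI hS hX hj i ((Ext.mk₀ (ModuleCat.ofHom φ)).comp x (zero_add i)) =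
      (Ext.mk₀ (ModuleCat.ofHom (φ.restrictScalars R))).comp
        (extBaseChangeEquiv X hI hS hX hj i x) (zero_add i) := by
  obtain ⟨y, hy⟩ := (postcomp_baseChange_bijective hI hS hX hj i).2 (restrictScalarsExt R S X M i x)
  have h : extBaseChangeEquiv X hI hS hX hj i x = y :=
    (AddEquiv.ofBijective _ (postcomp_baseChange_bijective hI hS hX hj i)).symm_apply_eq.2 hy.symm
  rw [h]
  refine (AddEquiv.ofBijective _
    (postcomp_baseChange_bijective hI hS hX hj i)).symm_apply_eq.2 ?_
  refine (restrictScalarsExt_mk₀_comp φ i x).trans ?_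
  rw [← hy]
  exact (Ext.comp_assoc_of_third_deg_zero _ _ _ _).symm

end BaseChange

end TorsionExt

namespace TorsionExt

/-! ### The adic completion: density and its action on torsion modules -/

section Completion

variable {R : Type*} [CommRing R]

theorem isDenseAt_adicCompletion {I : Ideal R} (hI : I ≠ ⊤) (hfg : I.FG) :
    IsDenseAt I (AdicCompletion I R) where
  exists_sub_mem n s := by
    obtain ⟨r, hr⟩ := Ideal.Quotient.mk_surjective (AdicCompletion.evalₐ I n s)
    refine ⟨r, ?_⟩
    have h0 : AdicCompletion.evalₐ I n (s - algebraMap R (AdicCompletion I R) r) = 0 := by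
      rw [map_sub, AlgHom.commutes, Ideal.Quotient.algebraMap_eq, hr, sub_self]
    have h1 : AdicCompletion.eval I R n (s - algebraMap R (AdicCompletion I R) r) = 0 := by
      refine (AdicCompletion.factor_evalₐ_eq_eval I _ (Ideal.mul_top _).ge).symm.trans ?_
      rw [h0, map_zero]
    have h2 : s - algebraMap R (AdicCompletion I R) r ∈
        (I ^ n • ⊤ : Submodule R (AdicCompletion I R)) := by
      -- Finite generation of `I` is what identifies the kernel of evaluation at level `n` with the
      -- extension of `Iⁿ`.
      rw [AdicCompletion.pow_smul_top_eq_ker_eval hfg]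
      exact h1
    rw [Ideal.smul_top_eq_map] at h2
    exact h2
  map_ne_top h := by
    have hle : I.map (algebraMap R (AdicCompletion I R)) ≤
        RingHom.ker (AdicCompletion.evalOneₐ I) := by
      refine Ideal.map_le_iff_le_comap.2 fun a ha => ?_
      change AdicCompletion.evalOneₐ I (algebraMap R (AdicCompletion I R) a) = 0
      rw [AlgHom.commutes, Ideal.Quotient.algebraMap_eq]
      exact Ideal.Quotient.eq_zero_iff_mem.2 ha
    have h1 : AdicCompletion.evalOneₐ I 1 = 0 := hle (h ▸ Submodule.mem_top)
    rw [map_one, ← map_one (Ideal.Quotient.mk I), Ideal.Quotient.eq_zero_iff_mem] at h1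
    exact hI ((Ideal.eq_top_iff_one I).2 h1)

/-- The action of the completion extends the action of `R`. -/
theorem completionAction_algebraMap {I : Ideal R} {M A : Type*} [AddCommGroup M] [Module R M]
    [CommRing A] [Algebra R A] [Module A M] [IsScalarTower R A M] (h : IsTorsionModule I M)
    (r : R) (x : M) : completionAction A h (algebraMap R _ r) x = r • x := by
  obtain ⟨n, hn⟩ := h.exists_pow x
  refine completionSMul_eq h hn ?_
  rw [AlgHom.commutes, Ideal.Quotient.algebraMap_eq]

/-- The action of the completion is natural. -/
theorem map_completionSMul {I : Ideal R} {M N : Type*} [AddCommGroup M] [Module R M]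
    [AddCommGroup N] [Module R N] (hM : IsTorsionModule I M) (hN : IsTorsionModule I N)
    (f : M →ₗ[R] N) (s : AdicCompletion I R) (x : M) :
    f (completionSMul hM s x) = completionSMul hN s (f x) := by
  obtain ⟨n, hn⟩ := hM.exists_pow x
  obtain ⟨r, hr⟩ := Ideal.Quotient.mk_surjective (AdicCompletion.evalₐ I n s)
  rw [completionSMul_eq hM hn hr,
    completionSMul_eq hN (fun a ha => by rw [← map_smul, hn a ha, map_zero]) hr, map_smul]

instance isScalarTower_primaryComponent (I : Ideal R) (M : Type*) [AddCommGroup M] [Module R M] :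
    IsScalarTower R (AdicCompletion I R) (Ideal.primaryComponent M I) where
  smul_assoc r s x := by
    rw [Algebra.smul_def, mul_smul]
    exact completionAction_algebraMap (A := R) (isTorsionModule_primaryComponent I M) r (s • x)

end Completion

/-! ### Localization at a maximal ideal and `Γ_𝔪(T) ≅ T_𝔪` -/

section Localization

variable {R : Type*} [CommRing R]

/-- By maximality `t` and `I` are comaximal, and comaximality passes to powers; `u` is an inverse of
`t` modulo `Iⁿ`. -/
theorem exists_mul_add_eq_one {I : Ideal R} (hI : I.IsMaximal) {t : R} (ht : t ∉ I) (n : ℕ) :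
    ∃ u, ∃ b ∈ I ^ n, u * t + b = 1 := by
  have h : Ideal.span {t} ⊔ I ^ n = ⊤ := Ideal.sup_pow_eq_top <| by
    by_contra hne
    have hle := hI.eq_of_le hne le_sup_right
    exact ht (hle ▸ Ideal.mem_sup_left (Ideal.mem_span_singleton_self t))
  obtain ⟨c, hc, b, hb, hcb⟩ := Submodule.mem_sup.1 ((Ideal.eq_top_iff_one _).1 h)
  obtain ⟨u, rfl⟩ := Ideal.mem_span_singleton'.1 hc
  exact ⟨u, b, hb, hcb⟩

theorem isDenseAt_localization {I : Ideal R} (hI : I.IsMaximal) :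
    IsDenseAt I (Localization.AtPrime I) where
  exists_sub_mem n s := by
    obtain ⟨⟨a, t⟩, rfl⟩ := IsLocalization.mk'_surjective I.primeCompl s
    obtain ⟨u, b, hb, h⟩ := exists_mul_add_eq_one hI t.2 n
    -- Modulo `Iⁿ` the fraction `a / t` is `u * a`; the error is exactly `(a / t) * b`.
    refine ⟨u * a, ?_⟩
    have h1 : IsLocalization.mk' (Localization.AtPrime I) a t -
        algebraMap R (Localization.AtPrime I) (u * a) =
        IsLocalization.mk' (Localization.AtPrime I) a t * algebraMap R _ b := by
      have h2 := congrArg (algebraMap R (Localization.AtPrime I)) h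
      have h3 := IsLocalization.mk'_spec (Localization.AtPrime I) a t
      simp only [map_add, map_mul, map_one] at h2 ⊢
      linear_combination (-IsLocalization.mk' (Localization.AtPrime I) a t) * h2 +
        algebraMap R _ u * h3
    rw [h1]
    exact Ideal.mul_mem_left _ _ (Ideal.mem_map_of_mem _ hb)
  map_ne_top := by
    rw [Localization.AtPrime.map_eq_maximalIdeal]
    exact Ideal.IsPrime.ne_top'

variable {T : Type*} [AddCommGroup T] [Module R T] (𝔪 : MaximalSpectrum R)

/-- The natural map `Γ_𝔪(T) → T_𝔪`. -/
def primaryComponentToLocalization (T : Type*) [AddCommGroup T] [Module R T]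
    (𝔪 : MaximalSpectrum R) :
    Ideal.primaryComponent T 𝔪.asIdeal →ₗ[R] LocalizedModule.AtPrime 𝔪.asIdeal T :=
  (LocalizedModule.mkLinearMap 𝔪.asIdeal.primeCompl T).comp (Submodule.subtype _)

/-- An element killed by some `s ∉ 𝔪` and by `𝔪ⁿ` is zero because these are comaximal, whence
injectivity. For surjectivity, denominators are inverted modulo the power of `𝔪` that kills the
given fraction. -/
theorem primaryComponentToLocalization_bijective [IsNoetherianRing R]
    (hT : IsTorsionModule 𝔪.asIdeal (LocalizedModule.AtPrime 𝔪.asIdeal T)) :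
    Function.Bijective (primaryComponentToLocalization T 𝔪) := by
  refine ⟨(injective_iff_map_eq_zero _).2 fun x hx => ?_, fun y => ?_⟩
  · obtain ⟨s, hs⟩ := (LocalizedModule.mem_ker_mkLinearMap_iff (S := 𝔪.asIdeal.primeCompl)).1
      (show x.1 ∈ LinearMap.ker (LocalizedModule.mkLinearMap 𝔪.asIdeal.primeCompl T) from hx)
    obtain ⟨n, hn⟩ := (isTorsionModule_primaryComponent 𝔪.asIdeal T).exists_pow x
    obtain ⟨u, b, hb, h⟩ := exists_mul_add_eq_one 𝔪.isMaximal hs.1 n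
    rw [← one_smul R x, ← h, add_smul, hn b hb, mul_smul,
      show s • x = 0 from Subtype.ext hs.2, smul_zero, zero_add]
  · induction y using LocalizedModule.induction_on with
    | h x t =>
      obtain ⟨n, hn⟩ := hT.exists_pow (LocalizedModule.mk x t)
      have h1 : ∀ a ∈ 𝔪.asIdeal ^ n, ∃ s ∉ 𝔪.asIdeal, s • a • x = 0 := fun a ha => by
        have h := hn a ha
        rw [LocalizedModule.smul'_mk, ← LocalizedModule.zero_mk t, LocalizedModule.mk_eq] at h
        obtain ⟨s, hs⟩ := h
        refine ⟨s * t, (s * t).2, ?_⟩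
        rw [smul_zero, smul_zero, smul_smul] at hs
        exact hs
      -- The multiplier `s` initially depends on `a`. As `𝔪ⁿ` is finitely generated, the product of
      -- the multipliers of the generators works for all `a`.
      obtain ⟨s, hs, hsn⟩ : ∃ s ∉ 𝔪.asIdeal, ∀ a ∈ 𝔪.asIdeal ^ n, s • a • x = 0 := by
        obtain ⟨F, hF⟩ := (isNoetherianRing_iff_ideal_fg R).1 inferInstance (𝔪.asIdeal ^ n)
        have h2 : ∀ a : F, ∃ s ∉ 𝔪.asIdeal, s • a.1 • x = 0 := fun a =>
          h1 a.1 (hF ▸ Ideal.subset_span a.2)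
        choose f hf hfa using h2
        have := 𝔪.isMaximal.isPrime
        refine ⟨∏ a, f a, fun h => ?_, fun a ha => ?_⟩
        · obtain ⟨a, -, ha⟩ := (Ideal.IsPrime.prod_mem_iff).1 h
          exact hf a ha
        · have hle : 𝔪.asIdeal ^ n ≤ LinearMap.ker
              ((∏ a, f a) • LinearMap.toSpanSingleton R T x) := by
            rw [← hF]
            refine Ideal.span_le.2 fun a ha => ?_
            change (∏ a, f a) • a • x = 0
            obtain ⟨c, hc⟩ := Finset.dvd_prod_of_mem f (Finset.mem_univ (⟨a, ha⟩ : F))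
            rw [hc, mul_comm, mul_smul, hfa ⟨a, ha⟩, smul_zero]
          exact hle ha
      have := 𝔪.isMaximal.isPrime
      obtain ⟨u, b, hb, h⟩ := exists_mul_add_eq_one 𝔪.isMaximal
        (𝔪.asIdeal.primeCompl.mul_mem hs t.2) n
      have hx : s • x ∈ Ideal.primaryComponent T 𝔪.asIdeal :=
        (Ideal.primaryComponent_mem _ _ _).2 ⟨n, (Submodule.mem_torsionBySet_iff _ _).2 fun a => by
          rw [smul_comm]
          exact hsn a a.2⟩
      -- The image is `(u * (s * t)) • (x / t) = (1 - b) • (x / t)`, and `b ∈ 𝔪ⁿ` kills `x / t`.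
      refine ⟨u • ⟨s • x, hx⟩, ?_⟩
      have h3 : (t : R) • LocalizedModule.mk x t =
          LocalizedModule.mkLinearMap 𝔪.asIdeal.primeCompl T x := by
        rw [LocalizedModule.smul'_mk]
        exact LocalizedModule.mk_cancel t x
      rw [map_smul]
      change u • LocalizedModule.mkLinearMap 𝔪.asIdeal.primeCompl T (s • x) = _
      rw [map_smul, ← h3, ← mul_smul, ← mul_smul, mul_assoc]
      conv_rhs => rw [← one_smul R (LocalizedModule.mk x t), ← h, add_smul, hn b hb, add_zero]

/-- The isomorphism `Γ_𝔪(T) ≅ T_𝔪`. -/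
def primaryComponentEquivLocalization [IsNoetherianRing R]
    (hT : IsTorsionModule 𝔪.asIdeal (LocalizedModule.AtPrime 𝔪.asIdeal T)) :
    Ideal.primaryComponent T 𝔪.asIdeal ≃ₗ[R] LocalizedModule.AtPrime 𝔪.asIdeal T :=
  LinearEquiv.ofBijective _ (primaryComponentToLocalization_bijective 𝔪 hT)

end Localization

/-! ### Primary decomposition of a `𝔠`-torsion module -/

section Decomposition

variable {R : Type*} [CommRing R] [IsNoetherianRing R] {T : Type*} [AddCommGroup T] [Module R T]

/-- The projection `T → Γ_𝔪(T)` obtained from `Γ_𝔪(T) ≅ T_𝔪`. -/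
def primaryComponentProj (𝔪 : MaximalSpectrum R)
    (hT : IsTorsionModule 𝔪.asIdeal (LocalizedModule.AtPrime 𝔪.asIdeal T)) :
    T →ₗ[R] Ideal.primaryComponent T 𝔪.asIdeal :=
  (primaryComponentEquivLocalization 𝔪 hT).symm.toLinearMap.comp
    (LocalizedModule.mkLinearMap 𝔪.asIdeal.primeCompl T)

theorem primaryComponentProj_subtype (𝔪 : MaximalSpectrum R)
    (hT : IsTorsionModule 𝔪.asIdeal (LocalizedModule.AtPrime 𝔪.asIdeal T)) :
    (primaryComponentProj 𝔪 hT).comp (Submodule.subtype _) = LinearMap.id := by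
  ext1 x
  exact (primaryComponentEquivLocalization 𝔪 hT).symm_apply_apply x

omit [IsNoetherianRing R] in
-- Some power of `𝔪` kills `x`, and no power of `𝔪` lies in `𝔫`. Thus `Γ_𝔪(T)` vanishes after
-- localizing at `𝔫`, which makes the projections orthogonal.
theorem exists_smul_eq_zero_of_ne {𝔪 𝔫 : MaximalSpectrum R} (h : 𝔪 ≠ 𝔫)
    (x : Ideal.primaryComponent T 𝔪.asIdeal) : ∃ s ∉ 𝔫.asIdeal, s • x = 0 := by
  obtain ⟨n, hn⟩ := (isTorsionModule_primaryComponent 𝔪.asIdeal T).exists_pow x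
  by_contra! hs
  refine h (MaximalSpectrum.ext (𝔪.isMaximal.eq_of_le 𝔫.isMaximal.ne_top
    (𝔫.isMaximal.isPrime.le_of_pow_le (n := n) fun a ha => ?_)))
  by_contra ha'
  exact hs a ha' (hn a ha)

theorem primaryComponentProj_subtype_of_ne {𝔪 𝔫 : MaximalSpectrum R} (h : 𝔪 ≠ 𝔫)
    (hT : IsTorsionModule 𝔫.asIdeal (LocalizedModule.AtPrime 𝔫.asIdeal T)) :
    (primaryComponentProj 𝔫 hT).comp (Ideal.primaryComponent T 𝔪.asIdeal).subtype = 0 := by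
  ext1 x
  obtain ⟨s, hs, hx⟩ := exists_smul_eq_zero_of_ne h x
  have h0 : LocalizedModule.mkLinearMap 𝔫.asIdeal.primeCompl T x.1 = 0 :=
    (LocalizedModule.mem_ker_mkLinearMap_iff (S := 𝔫.asIdeal.primeCompl)).2
      ⟨s, hs, congrArg Subtype.val hx⟩
  change (primaryComponentEquivLocalization 𝔫 hT).symm _ = 0
  exact (congrArg _ h0).trans (map_zero _)

/-- A `𝔠`-torsion module is the direct sum of its primary components at any finite set of maximal
ideals whose intersection is contained in `𝔠`. -/
theorem sum_subtype_primaryComponentProj {𝔠 : Ideal R} (hT𝔠 : IsTorsionModule 𝔠 T)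
    (hT : ∀ 𝔪 : MaximalSpectrum R,
      IsTorsionModule 𝔪.asIdeal (LocalizedModule.AtPrime 𝔪.asIdeal T))
    (𝒟 : Finset (MaximalSpectrum R)) (h𝒟 : ⨅ 𝔪 ∈ 𝒟, 𝔪.asIdeal ≤ 𝔠) :
    ∑ 𝔪 ∈ 𝒟, (Ideal.primaryComponent T 𝔪.asIdeal).subtype.comp (primaryComponentProj 𝔪 (hT 𝔪)) =
      (LinearMap.id : T →ₗ[R] T) := by
  classical
  refine LinearMap.ext fun x => ?_
  rw [← sub_eq_zero]
  set z := (∑ 𝔪 ∈ 𝒟, (Ideal.primaryComponent T 𝔪.asIdeal).subtype.comp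
    (primaryComponentProj 𝔪 (hT 𝔪))) x -
    (LinearMap.id : T →ₗ[R] T) x with hz
  -- The discrepancy `z` is shown to vanish locally at every maximal ideal; its annihilator is then
  -- in no maximal ideal, so `z = 0`.
  have key : ∀ 𝔫 : MaximalSpectrum R, ∃ s ∉ 𝔫.asIdeal, s • z = 0 := by
    intro 𝔫
    by_cases h𝔫 : 𝔫 ∈ 𝒟
    · have h0 : LocalizedModule.mkLinearMap 𝔫.asIdeal.primeCompl T z = 0 := by
        rw [hz, map_sub, LinearMap.sum_apply, map_sum, Finset.sum_eq_single_of_mem 𝔫 h𝔫]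
        · exact sub_eq_zero.2 ((primaryComponentEquivLocalization 𝔫 (hT 𝔫)).apply_symm_apply _)
        · intro 𝔪 _ hne
          obtain ⟨s, hs, h⟩ := exists_smul_eq_zero_of_ne hne (primaryComponentProj 𝔪 (hT 𝔪) x)
          exact (LocalizedModule.mem_ker_mkLinearMap_iff (S := 𝔫.asIdeal.primeCompl)).2
            ⟨s, hs, congrArg Subtype.val h⟩
      obtain ⟨s, hs⟩ := (LocalizedModule.mem_ker_mkLinearMap_iff
        (S := 𝔫.asIdeal.primeCompl)).1 (show z ∈ LinearMap.ker _ from h0)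
      exact ⟨s, hs.1, hs.2⟩
    -- Outside `𝒟`, the ideal `𝔫` does not contain `𝔠`, hence contains no power of `𝔠`, while some
    -- power of `𝔠` kills `z`.
    · obtain ⟨n, hn⟩ := hT𝔠.exists_pow z
      by_contra! hs
      have hle : 𝔠 ≤ 𝔫.asIdeal := 𝔫.isMaximal.isPrime.le_of_pow_le (n := n) fun a ha => by
        by_contra ha'
        exact hs a ha' (hn a ha)
      have hle' : 𝒟.inf MaximalSpectrum.asIdeal ≤ 𝔫.asIdeal := by
        rw [Finset.inf_eq_iInf]
        exact h𝒟.trans hle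
      obtain ⟨𝔪, h𝔪, h⟩ := (Ideal.IsPrime.inf_le' 𝔫.isMaximal.isPrime).1 hle'
      exact h𝔫 (MaximalSpectrum.ext (𝔪.isMaximal.eq_of_le 𝔫.isMaximal.ne_top h) ▸ h𝔪)
  by_contra hz0
  have hJ : LinearMap.ker (LinearMap.toSpanSingleton R T z) ≠ ⊤ := fun h => hz0 <| by
    have : (1 : R) ∈ LinearMap.ker (LinearMap.toSpanSingleton R T z) := h ▸ Submodule.mem_top
    simpa using this
  obtain ⟨P, hP, hJP⟩ := Ideal.exists_le_maximal _ hJ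
  obtain ⟨s, hs, h⟩ := key ⟨P, hP⟩
  exact hs (hJP h)

end Decomposition

end TorsionExt

namespace TorsionExt

/-- This puts the usual scalar action in the form used by `extModuleOfAction`, so that linearity
reduces to naturality in the first variable. -/
theorem smul_eq_mk₀_comp {A : Type u} [CommRing A] {X : Type u} [AddCommGroup X] [Module A X]
    {Y : ModuleCat.{u} A} {i : ℕ} (a : A) (x : Ext.{u} (ModuleCat.of A X) Y i) :
    a • x = (Ext.mk₀ (ModuleCat.ofHom (a • LinearMap.id : X →ₗ[A] X))).comp x (zero_add i) := by
  have h : ModuleCat.ofHom (a • LinearMap.id : X →ₗ[A] X) = a • 𝟙 (ModuleCat.of A X) := rfl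
  rw [h, Ext.mk₀_smul, Ext.smul_comp, Ext.mk₀_id_comp]

theorem sum_mk₀_comp_mk₀_comp {C : Type*} [Category C] [Abelian C] [HasExt.{u} C] {X Y : C} {n : ℕ}
    {J : Type*} (s : Finset J) {Z : J → C} (π : ∀ j, X ⟶ Z j) (ι : ∀ j, Z j ⟶ X)
    (x : Ext.{u} X Y n) :
    ∑ j ∈ s, (Ext.mk₀ (π j)).comp ((Ext.mk₀ (ι j)).comp x (zero_add n)) (zero_add n) =
      (Ext.mk₀ (∑ j ∈ s, π j ≫ ι j)).comp x (zero_add n) := by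
  classical
  induction s using Finset.induction_on with
  | empty => rw [Finset.sum_empty, Finset.sum_empty, Ext.mk₀_zero, Ext.zero_comp]
  | insert j s hj ih =>
    rw [Finset.sum_insert hj, Finset.sum_insert hj, ih, Ext.mk₀_add, Ext.add_comp,
      Ext.mk₀_comp_mk₀_assoc]

/-! ### Local comparison isomorphisms and the splitting of `Ext_R(T, L)` -/

section

variable {R : Type u} [CommRing R] [IsNoetherianRing R] (𝔪 : MaximalSpectrum R)
  (T L : Type u) [AddCommGroup T] [Module R T] [AddCommGroup L] [Module R L] (i : ℕ)

/-- `Ext` over `R` of `Γ_𝔪(T)` and `L`. -/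
abbrev ExtPrimaryComponent : Type u :=
  Ext.{u} (ModuleCat.of R (Ideal.primaryComponent T 𝔪.asIdeal)) (ModuleCat.of R L) i

/-- The comparison of `Ext` over the completion with `Ext` over `R`. -/
def extCompletionAddEquiv : ExtCompletion 𝔪 T L i ≃+ ExtPrimaryComponent 𝔪 T L i :=
  extBaseChangeEquiv (S := AdicCompletion 𝔪.asIdeal R) (Ideal.primaryComponent T 𝔪.asIdeal)
    𝔪.isMaximal
    (isDenseAt_adicCompletion 𝔪.isMaximal.ne_top (IsNoetherian.noetherian 𝔪.asIdeal))
    (isTorsionModule_primaryComponent 𝔪.asIdeal T)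
    (TensorProduct.isBaseChange R L (AdicCompletion 𝔪.asIdeal R)) i

theorem extCompletionAddEquiv_smul (s : AdicCompletion 𝔪.asIdeal R) (x : ExtCompletion 𝔪 T L i) :
    extCompletionAddEquiv 𝔪 T L i (s • x) =
      (Ext.mk₀ (ModuleCat.ofHom
        (completionAction R (isTorsionModule_primaryComponent 𝔪.asIdeal T) s))).comp
        (extCompletionAddEquiv 𝔪 T L i x) (zero_add i) :=
  (congrArg _ (smul_eq_mk₀_comp s _)).trans (extBaseChangeEquiv_mk₀_comp ..)

/-- The comparison of `Ext` over the completion with `Ext` over `R`. -/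
def extCompletionEquiv : ExtCompletion 𝔪 T L i ≃ₗ[R] ExtPrimaryComponent 𝔪 T L i where
  __ := extCompletionAddEquiv 𝔪 T L i
  map_smul' r x := by
    refine (extCompletionAddEquiv_smul 𝔪 T L i (algebraMap R _ r) x).trans ?_
    refine Eq.trans ?_ (smul_eq_mk₀_comp r _).symm
    congr 3
    exact LinearMap.ext fun x => completionAction_algebraMap _ r x

omit [IsNoetherianRing R] in
theorem ExtCompletion.isScalarTower {𝔞 : Ideal R} (h : 𝔞 ≤ 𝔪.asIdeal) :
    letI := ExtCompletion.module 𝔪 T L i h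
    IsScalarTower R (AdicCompletion 𝔞 R) (ExtCompletion 𝔪 T L i) := by
  let _ := ExtCompletion.module 𝔪 T L i h
  refine ⟨fun r s x => ?_⟩
  change completionMap h (r • s) • x =
    algebraMap R (AdicCompletion 𝔪.asIdeal R) r • completionMap h s • x
  rw [map_smul, Algebra.smul_def, mul_smul]

variable {T}

/-- The comparison of `Ext` over the localization with `Ext` over `R`. -/
def extLocalizationAddEquiv
    (hT : IsTorsionModule 𝔪.asIdeal (LocalizedModule.AtPrime 𝔪.asIdeal T)) :
    ExtLocalization 𝔪 T L i ≃+ ExtPrimaryComponent 𝔪 T L i :=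
  (extBaseChangeEquiv (S := Localization.AtPrime 𝔪.asIdeal) (LocalizedModule.AtPrime 𝔪.asIdeal T)
    𝔪.isMaximal (isDenseAt_localization 𝔪.isMaximal) hT
    (IsLocalizedModule.isBaseChange 𝔪.asIdeal.primeCompl (Localization.AtPrime 𝔪.asIdeal)
      (LocalizedModule.mkLinearMap 𝔪.asIdeal.primeCompl L)) i).trans
    (AddEquiv.ofBijective _ (precomp_iso_bijective
      (primaryComponentEquivLocalization 𝔪 hT).toModuleIso (ModuleCat.of R L) i))

/-- Stated for any pair of endomorphisms intertwined by `Γ_𝔪(T) → T_𝔪`, so as to cover both scalars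
of `R` and elements of the completion. -/
theorem extLocalizationAddEquiv_mk₀_comp
    (hT : IsTorsionModule 𝔪.asIdeal (LocalizedModule.AtPrime 𝔪.asIdeal T))
    (φ : Module.End (Localization.AtPrime 𝔪.asIdeal) (LocalizedModule.AtPrime 𝔪.asIdeal T))
    (ψ : Module.End R (Ideal.primaryComponent T 𝔪.asIdeal))
    (h : ∀ x, primaryComponentToLocalization T 𝔪 (ψ x) = φ (primaryComponentToLocalization T 𝔪 x))
    (x : ExtLocalization 𝔪 T L i) :
    extLocalizationAddEquiv 𝔪 L i hT
        ((Ext.mk₀ (ModuleCat.ofHom φ)).comp (show Ext.{u} _ _ i from x) (zero_add i)) =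
      (Ext.mk₀ (ModuleCat.ofHom ψ)).comp (extLocalizationAddEquiv 𝔪 L i hT x) (zero_add i) := by
  have h' : (primaryComponentEquivLocalization 𝔪 hT).toModuleIso.hom ≫
      ModuleCat.ofHom (φ.restrictScalars R) =
      ModuleCat.ofHom ψ ≫ (primaryComponentEquivLocalization 𝔪 hT).toModuleIso.hom :=
    ModuleCat.hom_ext (LinearMap.ext fun x => (h x).symm)
  refine (congrArg ((Ext.mk₀ (primaryComponentEquivLocalization 𝔪 hT).toModuleIso.hom).precomp
    (ModuleCat.of R L) (zero_add i)) (extBaseChangeEquiv_mk₀_comp ..)).trans ?_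
  refine (Ext.mk₀_comp_mk₀_assoc _ _ _).trans ?_
  rw [h']
  exact (Ext.mk₀_comp_mk₀_assoc _ _ _).symm

/-- The comparison of `Ext` over the localization with `Ext` over `R`. -/
def extLocalizationEquiv
    (hT : IsTorsionModule 𝔪.asIdeal (LocalizedModule.AtPrime 𝔪.asIdeal T)) :
    ExtLocalization 𝔪 T L i ≃ₗ[R] ExtPrimaryComponent 𝔪 T L i where
  __ := extLocalizationAddEquiv 𝔪 L i hT
  map_smul' r x := by
    refine (congrArg (extLocalizationAddEquiv 𝔪 L i hT)
      (smul_eq_mk₀_comp (algebraMap R (Localization.AtPrime 𝔪.asIdeal) r) _)).trans ?_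
    refine Eq.trans ?_ (smul_eq_mk₀_comp r _).symm
    refine extLocalizationAddEquiv_mk₀_comp 𝔪 L i hT _ _ (fun x => ?_) x
    refine (map_smul (primaryComponentToLocalization T 𝔪) r x).trans ?_
    exact (algebraMap_smul (Localization.AtPrime 𝔪.asIdeal) r _).symm

/-- The comparison of `Ext` over the completion with `Ext` over the localization. -/
def extCompletionEquivLocalization
    (hT : IsTorsionModule 𝔪.asIdeal (LocalizedModule.AtPrime 𝔪.asIdeal T)) :
    ExtCompletion 𝔪 T L i ≃ₗ[R] ExtLocalization 𝔪 T L i :=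
  (extCompletionEquiv 𝔪 T L i).trans (extLocalizationEquiv 𝔪 L i hT).symm

theorem extCompletionEquivLocalization_smul
    (hT : IsTorsionModule 𝔪.asIdeal (LocalizedModule.AtPrime 𝔪.asIdeal T)) {𝔞 : Ideal R}
    (h : 𝔞 ≤ 𝔪.asIdeal) (s : AdicCompletion 𝔞 R) (x : ExtCompletion 𝔪 T L i) :
    letI := ExtCompletion.module 𝔪 T L i h
    letI := ExtLocalization.module L i hT h
    extCompletionEquivLocalization 𝔪 L i hT (s • x) =
      s • extCompletionEquivLocalization 𝔪 L i hT x := by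
  -- Both sides are compared inside `Ext_R(Γ_𝔪(T), L)`, where each action is precomposition with the
  -- action of the completion on `Γ_𝔪(T)`.
  refine (extLocalizationAddEquiv 𝔪 L i hT).symm_apply_eq.2 ?_
  refine (extCompletionAddEquiv_smul 𝔪 T L i (completionMap h s) x).trans ?_
  refine Eq.trans ?_ (extLocalizationAddEquiv_mk₀_comp 𝔪 L i hT
    (completionAction _ hT (completionMap h s))
    (completionAction R (isTorsionModule_primaryComponent 𝔪.asIdeal T) (completionMap h s))
    (fun y => map_completionSMul (isTorsionModule_primaryComponent 𝔪.asIdeal T) hT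
      (primaryComponentToLocalization T 𝔪) _ y) _).symm
  congr 1
  exact ((extLocalizationAddEquiv 𝔪 L i hT).apply_symm_apply _).symm

variable {L} in
-- After passing to Ext over `R_𝔪`, one of `T_𝔪`, `L_𝔪` is zero, so its identity map is zero and
-- kills every class.
theorem subsingleton_extPrimaryComponent
    (hT : IsTorsionModule 𝔪.asIdeal (LocalizedModule.AtPrime 𝔪.asIdeal T))
    (h : 𝔪.toPrimeSpectrum ∉ Module.support R T ∩ Module.support R L) :
    Subsingleton (ExtPrimaryComponent 𝔪 T L i) := by
  have key : Subsingleton (ExtLocalization 𝔪 T L i) := by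
    rw [Set.mem_inter_iff, not_and_or, Module.notMem_support_iff, Module.notMem_support_iff] at h
    refine subsingleton_of_forall_eq 0 fun (x : Ext.{u} _ _ i) => ?_
    rcases h with h | h
    · have h0 : 𝟙 (ModuleCat.of (Localization.AtPrime 𝔪.asIdeal)
          (LocalizedModule.AtPrime 𝔪.asIdeal T)) = 0 :=
        ModuleCat.hom_ext (LinearMap.ext fun y => h.elim _ _)
      refine (Ext.mk₀_id_comp x).symm.trans ?_
      rw [h0, Ext.mk₀_zero, Ext.zero_comp]
      rfl
    · have h0 : 𝟙 (ModuleCat.of (Localization.AtPrime 𝔪.asIdeal)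
          (LocalizedModule.AtPrime 𝔪.asIdeal L)) = 0 :=
        ModuleCat.hom_ext (LinearMap.ext fun y => h.elim _ _)
      refine (Ext.comp_mk₀_id x).symm.trans ?_
      rw [h0, Ext.mk₀_zero, Ext.comp_zero]
      rfl
  exact (extLocalizationEquiv 𝔪 L i hT).symm.injective.subsingleton

/-- The map `Ext_R(T, L) → Ext_R(Γ_𝔪(T), L)`. -/
def extRestrict (x : Ext.{u} (ModuleCat.of R T) (ModuleCat.of R L) i) :
    ExtPrimaryComponent 𝔪 T L i :=
  (Ext.mk₀ (ModuleCat.ofHom (Ideal.primaryComponent T 𝔪.asIdeal).subtype)).comp x (zero_add i)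

/-- The map `Ext_R(Γ_𝔪(T), L) → Ext_R(T, L)` induced by the projection `T → Γ_𝔪(T)`. -/
def extInflate (hT : IsTorsionModule 𝔪.asIdeal (LocalizedModule.AtPrime 𝔪.asIdeal T))
    (y : ExtPrimaryComponent 𝔪 T L i) : Ext.{u} (ModuleCat.of R T) (ModuleCat.of R L) i :=
  (Ext.mk₀ (ModuleCat.ofHom (primaryComponentProj 𝔪 hT))).comp y (zero_add i)

variable {L i}

theorem extRestrict_extInflate
    (hT : IsTorsionModule 𝔪.asIdeal (LocalizedModule.AtPrime 𝔪.asIdeal T))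
    (y : ExtPrimaryComponent 𝔪 T L i) : extRestrict 𝔪 L i (extInflate 𝔪 L i hT y) = y := by
  refine (Ext.mk₀_comp_mk₀_assoc _ _ _).trans ?_
  rw [← ModuleCat.ofHom_comp, primaryComponentProj_subtype]
  exact Ext.mk₀_id_comp _

theorem extRestrict_extInflate_of_ne {𝔪 𝔫 : MaximalSpectrum R} (h : 𝔫 ≠ 𝔪)
    (hT : IsTorsionModule 𝔪.asIdeal (LocalizedModule.AtPrime 𝔪.asIdeal T))
    (y : ExtPrimaryComponent 𝔪 T L i) : extRestrict 𝔫 L i (extInflate 𝔪 L i hT y) = 0 := by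
  refine (Ext.mk₀_comp_mk₀_assoc _ _ _).trans ?_
  rw [← ModuleCat.ofHom_comp, primaryComponentProj_subtype_of_ne h,
    show ModuleCat.ofHom (0 : Ideal.primaryComponent T 𝔫.asIdeal →ₗ[R]
      Ideal.primaryComponent T 𝔪.asIdeal) = 0 from rfl, Ext.mk₀_zero, Ext.zero_comp]

theorem sum_extInflate_extRestrict {𝔠 : Ideal R} (hT𝔠 : IsTorsionModule 𝔠 T)
    (hT : ∀ 𝔪 : MaximalSpectrum R,
      IsTorsionModule 𝔪.asIdeal (LocalizedModule.AtPrime 𝔪.asIdeal T))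
    (𝒟 : Finset (MaximalSpectrum R)) (h𝒟 : ⨅ 𝔪 ∈ 𝒟, 𝔪.asIdeal ≤ 𝔠)
    (x : Ext.{u} (ModuleCat.of R T) (ModuleCat.of R L) i) :
    ∑ 𝔪 ∈ 𝒟, extInflate 𝔪 L i (hT 𝔪) (extRestrict 𝔪 L i x) = x := by
  refine (sum_mk₀_comp_mk₀_comp 𝒟 _ _ _).trans ?_
  rw [show ∑ 𝔪 ∈ 𝒟, ModuleCat.ofHom (primaryComponentProj 𝔪 (hT 𝔪)) ≫
      ModuleCat.ofHom (Ideal.primaryComponent T 𝔪.asIdeal).subtype = 𝟙 (ModuleCat.of R T) from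
    ModuleCat.hom_ext ((ModuleCat.hom_sum _ _).trans
      (sum_subtype_primaryComponentProj hT𝔠 hT 𝒟 h𝒟))]
  exact Ext.mk₀_id_comp x

variable (i) in
/-- `Ext_R(T, L)` is the product of the `Ext_R(Γ_𝔪(T), L)`. -/
def extEquivPi {𝔠 : Ideal R} {𝒞 : Finset (MaximalSpectrum R)} (h𝔠 : 𝔠 = ⨅ 𝔪 ∈ 𝒞, 𝔪.asIdeal)
    (hT𝔠 : IsTorsionModule 𝔠 T) (hT : ∀ 𝔪 : MaximalSpectrum R,
      IsTorsionModule 𝔪.asIdeal (LocalizedModule.AtPrime 𝔪.asIdeal T))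
    (𝒢 : Finset (MaximalSpectrum R))
    (h𝒢 : Module.support R T ∩ Module.support R L ⊆
      MaximalSpectrum.toPrimeSpectrum '' (𝒢 : Set (MaximalSpectrum R))) :
    Ext.{u} (ModuleCat.of R T) (ModuleCat.of R L) i ≃ₗ[R]
      ∀ 𝔪 : 𝒢, ExtPrimaryComponent 𝔪.1 T L i where
  toFun x 𝔪 := extRestrict 𝔪.1 L i x
  map_add' x y := funext fun 𝔪 => Ext.comp_add ..
  map_smul' r x := funext fun 𝔪 => Ext.comp_smul ..
  invFun y := ∑ 𝔪 : 𝒢, extInflate 𝔪.1 L i (hT 𝔪.1) (y 𝔪)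
  left_inv x := by
    classical
    -- The set `𝒢` alone need not decompose `T`. Adding `𝒞` brings the intersection inside `𝔠`, and
    -- the extra terms vanish because they lie outside one of the supports.
    refine Eq.trans ?_ (sum_extInflate_extRestrict hT𝔠 hT (𝒞 ∪ 𝒢) ?_ x)
    · refine (Finset.sum_coe_sort 𝒢
        fun 𝔪 => extInflate 𝔪 L i (hT 𝔪) (extRestrict 𝔪 L i x)).trans ?_
      refine Finset.sum_subset Finset.subset_union_right fun 𝔪 _ h𝔪 => ?_
      have := subsingleton_extPrimaryComponent (L := L) 𝔪 i (hT 𝔪) fun h => by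
        obtain ⟨𝔫, h𝔫, h⟩ := h𝒢 h
        exact h𝔪 (MaximalSpectrum.toPrimeSpectrum_injective h ▸ h𝔫)
      rw [Subsingleton.elim (extRestrict 𝔪 L i x) 0]
      exact Ext.comp_zero ..
    · rw [h𝔠]
      exact biInf_mono fun 𝔪 h𝔪 => Finset.mem_union_left _ h𝔪
  right_inv y := by
    classical
    funext 𝔫
    refine (Ext.comp_sum ..).trans ((Finset.sum_eq_single 𝔫 ?_ ?_).trans
      (extRestrict_extInflate 𝔫.1 (hT 𝔫.1) (y 𝔫)))
    · exact fun 𝔪 _ hne =>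
        extRestrict_extInflate_of_ne (fun h => hne (Subtype.ext h.symm)) (hT 𝔪.1) (y 𝔪)
    · exact fun h => absurd (Finset.mem_univ _) h

end

end TorsionExt

end

theorem theoremB {R : Type u} [CommRing R] [IsNoetherianRing R]
    (𝒞 : Finset (MaximalSpectrum R)) (𝔠 : Ideal R) (h𝔠 : 𝔠 = ⨅ 𝔪 ∈ 𝒞, 𝔪.asIdeal)
    (T L : Type u) [AddCommGroup T] [Module R T] [AddCommGroup L] [Module R L]
    (hT : TorsionExt.IsTorsionModule 𝔠 T)
    (𝒢 : Finset (MaximalSpectrum R))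
    (h𝒢 : Module.support R T ∩ Module.support R L ⊆
      MaximalSpectrum.toPrimeSpectrum '' (𝒢 : Set (MaximalSpectrum R)))
    (i : ℕ) :
    ∃ (e₁ : Ext.{u} (ModuleCat.of R T) (ModuleCat.of R L) i ≃ₗ[R]
          ⨁ 𝔪 : 𝒢, TorsionExt.ExtCompletion 𝔪.1 T L i)
      (e₂ : (⨁ 𝔪 : 𝒢, TorsionExt.ExtCompletion 𝔪.1 T L i) ≃ₗ[R]
          ⨁ 𝔪 : 𝒢, TorsionExt.ExtLocalization 𝔪.1 T L i),
      ∀ (𝔞 : Ideal R) (h𝔞 : 𝔞 ≤ ⨅ 𝔪 ∈ 𝒢, 𝔪.asIdeal),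
        letI : ∀ 𝔪 : 𝒢, Module (AdicCompletion 𝔞 R) (TorsionExt.ExtCompletion 𝔪.1 T L i) :=
          fun 𝔪 => TorsionExt.ExtCompletion.module 𝔪.1 T L i (h𝔞.trans (iInf₂_le 𝔪.1 𝔪.2))
        letI : ∀ 𝔪 : 𝒢, Module (AdicCompletion 𝔞 R) (TorsionExt.ExtLocalization 𝔪.1 T L i) :=
          fun 𝔪 => TorsionExt.ExtLocalization.module L i
            (TorsionExt.isTorsionModule_localization h𝔠 hT 𝔪.1) (h𝔞.trans (iInf₂_le 𝔪.1 𝔪.2))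
        (∀ (s : AdicCompletion 𝔞 R) (z : ⨁ 𝔪 : 𝒢, TorsionExt.ExtCompletion 𝔪.1 T L i),
          e₂ (s • z) = s • e₂ z) ∧
        ∃ _ : Module (AdicCompletion 𝔞 R) (Ext.{u} (ModuleCat.of R T) (ModuleCat.of R L) i),
          IsScalarTower R (AdicCompletion 𝔞 R)
            (Ext.{u} (ModuleCat.of R T) (ModuleCat.of R L) i) ∧
          ∀ (s : AdicCompletion 𝔞 R) (x : Ext.{u} (ModuleCat.of R T) (ModuleCat.of R L) i),
            e₁ (s • x) = s • e₁ x := by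
  have hT' := TorsionExt.isTorsionModule_localization h𝔠 hT
  let e₁ : Ext.{u} (ModuleCat.of R T) (ModuleCat.of R L) i ≃ₗ[R]
      ⨁ 𝔪 : 𝒢, TorsionExt.ExtCompletion 𝔪.1 T L i := by
    classical
    exact (TorsionExt.extEquivPi i h𝔠 hT hT' 𝒢 h𝒢).trans
      ((LinearEquiv.piCongrRight fun 𝔪 : 𝒢 => (TorsionExt.extCompletionEquiv 𝔪.1 T L i).symm).trans
        (DirectSum.linearEquivFunOnFintype R 𝒢
          fun 𝔪 => TorsionExt.ExtCompletion 𝔪.1 T L i).symm)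
  refine ⟨e₁, DirectSum.congrLinearEquiv fun 𝔪 : 𝒢 =>
    TorsionExt.extCompletionEquivLocalization 𝔪.1 L i (hT' 𝔪.1), fun 𝔞 h𝔞 => ?_⟩
  let _ : ∀ 𝔪 : 𝒢, Module (AdicCompletion 𝔞 R) (TorsionExt.ExtCompletion 𝔪.1 T L i) :=
    fun 𝔪 => TorsionExt.ExtCompletion.module 𝔪.1 T L i (h𝔞.trans (iInf₂_le 𝔪.1 𝔪.2))
  refine ⟨fun s z => ?_, ?_⟩
  · refine DFinsupp.ext fun 𝔪 => ?_
    exact TorsionExt.extCompletionEquivLocalization_smul 𝔪.1 L i (hT' 𝔪.1) _ s (z 𝔪)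
  · have htower : ∀ 𝔪 : 𝒢, IsScalarTower R (AdicCompletion 𝔞 R)
        (TorsionExt.ExtCompletion 𝔪.1 T L i) :=
      fun 𝔪 => TorsionExt.ExtCompletion.isScalarTower 𝔪.1 T L i _
    -- The structure is transported along `e₁`, so `e₁` is linear by construction; compatibility
    -- with `R` comes from the scalar towers on the summands.
    let _ : Module (AdicCompletion 𝔞 R) (Ext.{u} (ModuleCat.of R T) (ModuleCat.of R L) i) :=
      e₁.toAddEquiv.module _
    refine ⟨inferInstance, ⟨fun r s x => ?_⟩, fun s x => e₁.apply_symm_apply _⟩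
    refine e₁.symm_apply_eq.2 ?_
    rw [map_smul]
    refine (smul_assoc r s (e₁ x)).trans ?_
    exact congrArg (r • ·) (e₁.apply_symm_apply _).symm
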